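/- Let $\gamma\in\mathbb R\setminus\{0,1,2,-2\}$ and consider the equation $F_0+\epsilon F_1=0$, where $$F_0=u_{tt}-\Big[\big(1+\tfrac u\gamma\big)^{\gamma-1}\Big]_{xx},\qquad F_1=u_t,$$ for $u=u(t,x)$, i.e. $u_{tt}+\epsilon u_t=[(1+u/\gamma)^{\gamma-1}]_{xx}$. Let $D$ be a connected open set of points $(t,x,u)$ with $1+u/\gamma>0$. A vector field $V=\tau\partial_t+\xi\partial_x+\eta\partial_u$ on $D$ is an (exact) symmetry generator for a given $\epsilon$ if its second prolongation satisfies $(\mathrm{pr}\,V)(F_0+\epsilon F_1)=0$ at all second-order jets over $D$ with $F_0+\epsilon F_1=0$. A family $X=V_0+\epsilon V_1$ is a first-order approximate symmetry generator (in the sense of Baikov, Gazizov and Ibragimov) if $(\mathrm{pr}\,X)(F_0+\epsilon F_1)=o(\epsilon)$ as $\epsilon\to0$ along every family of second-order jets $j_\epsilon$ that converges to $j_0$ over $D$ as $\epsilon\to0$ and satisfies $F_0+\epsilon F_1=o(\epsilon)$. (1) For all real constants $c_1,\dots,c_4,k_1,\dots,k_4$ the operator $$X=\Big[c_1t+c_2+\epsilon\Big(\tfrac{\gamma-2}{\gamma+2}c_1\tfrac{t^2}{2}+k_1t+k_2\Big)\Big]\partial_t+\Big[(c_1+c_3)x+c_4+\epsilon\big((k_1+k_3)x+k_4\big)\Big]\partial_x$$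 $$\qquad+\Big[\tfrac{2\gamma}{\gamma-2}c_3\big(1+\tfrac u\gamma\big)+2\epsilon\tfrac{\gamma}{\gamma-2}\Big(k_3-\tfrac{\gamma-2}{\gamma+2}c_1t\Big)\big(1+\tfrac u\gamma\big)\Big]\partial_u$$ is a first-order approximate symmetry generator. If moreover $\gamma\neq\frac23$, these are exactly all of them: for smooth vector fields $V_0,V_1$ on $D$, $V_0+\epsilon V_1$ is a first-order approximate symmetry generator if and only if it is of this form on $D$. (2) Put $X_1^0=t\partial_t+x\partial_x$, $X_2=X_2^0=\partial_t$, $X_3=X_3^0=\partial_x$, $X_4=X_4^0=x\partial_x+\frac{2\gamma}{\gamma-2}(1+\frac u\gamma)\partial_u$, $$Z=\tfrac{\gamma-2}{\gamma+2}t\partial_t-\tfrac{2\gamma}{\gamma+2}\big(1+\tfrac u\gamma\big)\partial_u,\quad Y=\tfrac{\gamma-2}{\gamma+2}\tfrac{t^2}{2}\partial_t-\tfrac{2\gamma t}{\gamma+2}\big(1+\tfrac u\gamma\big)\partial_u,\quad X_1=X_1^0+\epsilon Y.$$ Then $X=c_1X_1+c_2X_2+c_4X_3+c_3X_4+\epsilon(k_1X_1^0+k_2X_2^0+k_4X_3^0+k_3X_4^0)$;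 the operators $X_1,\dots,X_4$ are first-order approximate symmetry generators; the operators $X_1^0,\dots,X_4^0$ are exact symmetry generators for $\epsilon=0$; and if $\gamma\ne\frac23$, the smooth exact symmetry generators on $D$ for $\epsilon=0$ are exactly their real linear combinations. (3) For every real $\epsilon$ one has exactly $$[X_2,X_1]=X_2+\epsilon Z,\quad [X_2,X_4]=[X_2,X_3]=[X_1,X_4]=0,\quad [X_1,X_3]=-X_3,\quad [X_3,X_4]=X_3,$$ $$[X_1,Z]=-\epsilon\tfrac{\gamma-2}{\gamma+2}Y,\quad [X_1,Y]=Y,\quad [X_2,Y]=Z,\quad [X_2,Z]=\tfrac{\gamma-2}{\gamma+2}X_2,\quad [Z,Y]=\tfrac{\gamma-2}{\gamma+2}Y,$$ $$[X_3,Y]=[X_3,Z]=[X_4,Y]=[X_4,Z]=0.$$ The span of $X_1,\dots,X_4$ is closed under the commutator if and only if $\epsilon=0$, whereas the span of $X_1,\dots,X_4,Z,Y$ always is a finite-dimensional Lie algebra. There is an abstract six-dimensional real Lie algebra with a basis satisfying the same relations, and mapping the basis elements to the operators $X_1,\dots,X_4,Z,Y$ gives a Lie algebra homomorphism, i.e.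 a realization. (4) The span of $X_2,Z,Y$ is a Lie subalgebra isomorphic to $sl(2,\mathbb R)$, both for the operators and in the abstract algebra. If $\frac{\gamma+2}{\gamma-2}>0$, the elements $T=\sqrt{2\frac{\gamma+2}{\gamma-2}}\,(Y+X_2)$, $S=\sqrt{2\frac{\gamma+2}{\gamma-2}}\,(Y-X_2)$ and $Z'=2\frac{\gamma+2}{\gamma-2}Z$ satisfy $[Z',T]=2S$, $[T,S]=2Z'$, $[S,Z']=-2T$. -/

import Mathlib

open scoped ContDiff Topology

noncomputable section

namespace BinomialWave

/-! ### Jet spaces of functions `u = u(t, x)` -/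

/-- Points `(t, x, u)`. -/
abbrev J0 : Type := ℝ × ℝ × ℝ

/-- First-order jets `((t, x, u), (u_t, u_x))`. -/
abbrev J1 : Type := J0 × (ℝ × ℝ)

/-- Second-order jets `(((t, x, u), (u_t, u_x)), (u_tt, u_tx, u_xx))`. -/
abbrev J2 : Type := J1 × (ℝ × ℝ × ℝ)

/-- Total derivative `D_t = ∂_t + u_t ∂_u` of a function of `(t, x, u)`. -/
def Dt0 (f : J0 → ℝ) (j : J1) : ℝ := fderiv ℝ f j.1 (1, 0, j.2.1)

/-- Total derivative `D_x = ∂_x + u_x ∂_u` of a function of `(t, x, u)`. -/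
def Dx0 (f : J0 → ℝ) (j : J1) : ℝ := fderiv ℝ f j.1 (0, 1, j.2.2)

/-- Total derivative `D_t = ∂_t + u_t ∂_u + u_tt ∂_{u_t} + u_tx ∂_{u_x}` of a function of
first-order jets. -/
def Dt1 (g : J1 → ℝ) (j : J2) : ℝ :=
  fderiv ℝ g j.1 ((1, 0, j.1.2.1), (j.2.1, j.2.2.1))

/-- Total derivative `D_x = ∂_x + u_x ∂_u + u_tx ∂_{u_t} + u_xx ∂_{u_x}` of a function of
first-order jets. -/
def Dx1 (g : J1 → ℝ) (j : J2) : ℝ :=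
  fderiv ℝ g j.1 ((0, 1, j.1.2.2), (j.2.2.1, j.2.2.2))

/-! ### Prolongation of a vector field `V = τ ∂_t + ξ ∂_x + η ∂_u` -/

/-- `η^t = D_t η - u_t D_t τ - u_x D_t ξ`. -/
def etaT (V : J0 → J0) (j : J1) : ℝ :=
  Dt0 (fun p => (V p).2.2) j - j.2.1 * Dt0 (fun p => (V p).1) j
    - j.2.2 * Dt0 (fun p => (V p).2.1) j

/-- `η^x = D_x η - u_t D_x τ - u_x D_x ξ`. -/
def etaX (V : J0 → J0) (j : J1) : ℝ :=
  Dx0 (fun p => (V p).2.2) j - j.2.1 * Dx0 (fun p => (V p).1) j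
    - j.2.2 * Dx0 (fun p => (V p).2.1) j

/-- `η^tt = D_t η^t - u_tt D_t τ - u_tx D_t ξ`. -/
def etaTT (V : J0 → J0) (j : J2) : ℝ :=
  Dt1 (etaT V) j - j.2.1 * Dt0 (fun p => (V p).1) j.1
    - j.2.2.1 * Dt0 (fun p => (V p).2.1) j.1

/-- `η^tx = D_x η^t - u_tt D_x τ - u_tx D_x ξ`. -/
def etaTX (V : J0 → J0) (j : J2) : ℝ :=
  Dx1 (etaT V) j - j.2.1 * Dx0 (fun p => (V p).1) j.1
    - j.2.2.1 * Dx0 (fun p => (V p).2.1) j.1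

/-- `η^xx = D_x η^x - u_tx D_x τ - u_xx D_x ξ`. -/
def etaXX (V : J0 → J0) (j : J2) : ℝ :=
  Dx1 (etaX V) j - j.2.2.1 * Dx0 (fun p => (V p).1) j.1
    - j.2.2.2 * Dx0 (fun p => (V p).2.1) j.1

/-- The second prolongation of `V`, a vector field on the space of second-order jets. -/
def prolong (V : J0 → J0) (j : J2) : J2 :=
  ((V j.1.1, (etaT V j.1, etaX V j.1)), (etaTT V j, etaTX V j, etaXX V j))

/-- The second prolongation of `V` applied to a function of second-order jets. -/
def prolongApply (V : J0 → J0) (F : J2 → ℝ) (j : J2) : ℝ := fderiv ℝ F j (prolong V j)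

/-! ### The equation and its symmetries -/

/-- `F_0 = u_tt - [(1 + u/γ)^(γ-1)]_xx`. -/
def F0 (γ : ℝ) (j : J2) : ℝ :=
  j.2.1 - Dx1 (Dx0 fun p => (1 + p.2.2 / γ) ^ (γ - 1)) j

/-- `F_1 = u_t`. -/
def F1 (j : J2) : ℝ := j.1.2.1

/-- The equation `u_tt + ε u_t = [(1 + u/γ)^(γ-1)]_xx` is `F_0 + ε F_1 = 0`. -/
def F (γ ε : ℝ) (j : J2) : ℝ := F0 γ j + ε * F1 j

/-- The points `(t, x, u)` at which the power `(1 + u/γ)^(γ-1)` has positive base. -/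
def posRegion (γ : ℝ) : Set J0 := {p | 0 < 1 + p.2.2 / γ}

/-- `V` generates an exact point symmetry, over the region `D`, of the equation with
parameter `ε`: `(pr V) F = 0` wherever `F = 0`. -/
def IsSymmetry (γ ε : ℝ) (D : Set J0) (V : J0 → J0) : Prop :=
  ∀ j : J2, j.1.1 ∈ D → F γ ε j = 0 → prolongApply V (F γ ε) j = 0

/-- The family `X ε` (in practice `X_0 + ε X_1`) generates, over the region `D`, a
first-order approximate symmetry of `F_0 + ε F_1 = 0` in the sense of Baikov, Gazizov and
Ibragimov: `(pr X) F = o(ε)` whenever `F = o(ε)`, as `ε → 0`. The condition `F = o(ε)` is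
imposed on `ε`-dependent jets `j ε` that converge to a jet over `D`. -/
def IsApproxSymmetry (γ : ℝ) (D : Set J0) (X : ℝ → J0 → J0) : Prop :=
  ∀ j : ℝ → J2, ContinuousAt j 0 → (j 0).1.1 ∈ D →
    (fun ε : ℝ => F γ ε (j ε)) =o[𝓝 0] (fun ε : ℝ => ε) →
    (fun ε : ℝ => prolongApply (X ε) (F γ ε) (j ε)) =o[𝓝 0] (fun ε : ℝ => ε)

/-- The general approximate generator, with constants `c_1, …, c_4` (here `c 0, …, c 3`)
and `k_1, …, k_4` (here `k 0, …, k 3`). -/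
def generalX (γ : ℝ) (c k : Fin 4 → ℝ) (ε : ℝ) (p : J0) : J0 :=
  (c 0 * p.1 + c 1 + ε * ((γ - 2) / (γ + 2) * c 0 * (p.1 ^ 2 / 2) + k 0 * p.1 + k 1),
   (c 0 + c 2) * p.2.1 + c 3 + ε * ((k 0 + k 2) * p.2.1 + k 3),
   2 * γ / (γ - 2) * c 2 * (1 + p.2.2 / γ)
     + 2 * ε * (γ / (γ - 2)) * (k 2 - (γ - 2) / (γ + 2) * c 0 * p.1) * (1 + p.2.2 / γ))

/-! ### The Lie algebra of smooth vector fields on the space of `(t, x, u)` -/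

/-- Smooth vector fields on `ℝ³`. -/
def SmoothVF : Submodule ℝ (J0 → J0) where
  carrier := {V | ContDiff ℝ ∞ V}
  add_mem' := by
    intro V W hV hW
    exact ContDiff.add (Set.mem_ofPred_eq ▸ hV) (Set.mem_ofPred_eq ▸ hW)
  zero_mem' := (contDiff_const : ContDiff ℝ ∞ fun _ : J0 => (0 : J0))
  smul_mem' := by
    intro a V hV
    exact ContDiff.const_smul a (Set.mem_ofPred_eq ▸ hV)

theorem contDiff_coe (V : SmoothVF) : ContDiff ℝ ∞ (V : J0 → J0) := V.2

theorem differentiableAt_coe (V : SmoothVF) (p : J0) :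
    DifferentiableAt ℝ (V : J0 → J0) p :=
  ((contDiff_coe V).differentiable (by simp)).differentiableAt

/-- The commutator of vector fields, `[V, W] = DW·V - DV·W`, that is
`[V, W] f = V (W f) - W (V f)`. -/
instance : Bracket SmoothVF SmoothVF where
  bracket V W := ⟨VectorField.lieBracket ℝ (V : J0 → J0) W,
    ContDiff.lieBracket_vectorField (n := ∞) (m := ∞) V.2 W.2 (by simp)⟩

theorem coe_lie (V W : SmoothVF) :
    ((⁅V, W⁆ : SmoothVF) : J0 → J0) = VectorField.lieBracket ℝ (V : J0 → J0) W := rfl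

instance : LieRing SmoothVF where
  add_lie U V W := Subtype.ext <| funext fun p => by
    simpa [coe_lie] using VectorField.lieBracket_add_left (W := (W : J0 → J0))
      (differentiableAt_coe U p) (differentiableAt_coe V p)
  lie_add U V W := Subtype.ext <| funext fun p => by
    simpa [coe_lie] using VectorField.lieBracket_add_right (V := (U : J0 → J0))
      (differentiableAt_coe V p) (differentiableAt_coe W p)
  lie_self U := Subtype.ext <| by simp [coe_lie]
  leibniz_lie U V W := Subtype.ext <| funext fun p => by
    have h2 : minSmoothness ℝ 2 ≤ (∞ : WithTop ℕ∞) := by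
      rw [minSmoothness_of_isRCLikeNormedField]; exact WithTop.coe_le_coe.2 (le_top : (2 : ℕ∞) ≤ ⊤)
    simpa [coe_lie] using VectorField.leibniz_identity_lieBracket (𝕜 := ℝ) (n := ∞) h2
      (contDiff_coe U).contDiffAt (contDiff_coe V).contDiffAt
      ((contDiff_coe W).contDiffAt (x := p))

instance : LieAlgebra ℝ SmoothVF where
  lie_smul a V W := Subtype.ext <| funext fun p => by
    simpa [coe_lie] using VectorField.lieBracket_const_smul_right (V := (V : J0 → J0))
      (c := a) (differentiableAt_coe W p)

/-! ### The operators -/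

/-- `X_1^0 = t ∂_t + x ∂_x`. -/
def X10 : SmoothVF := ⟨fun p => (p.1, p.2.1, 0), by
  change ContDiff ℝ ∞ _; fun_prop⟩

/-- `X_2 = X_2^0 = ∂_t`. -/
def X2 : SmoothVF := ⟨fun _ => (1, 0, 0), by
  change ContDiff ℝ ∞ _; fun_prop⟩

/-- `X_3 = X_3^0 = ∂_x`. -/
def X3 : SmoothVF := ⟨fun _ => (0, 1, 0), by
  change ContDiff ℝ ∞ _; fun_prop⟩

/-- `X_4 = X_4^0 = x ∂_x + (2γ/(γ-2)) (1 + u/γ) ∂_u`. -/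
def X4 (γ : ℝ) : SmoothVF :=
  ⟨fun p => (0, p.2.1, 2 * γ / (γ - 2) * (1 + p.2.2 / γ)), by
    change ContDiff ℝ ∞ _; fun_prop⟩

/-- `Z = ((γ-2)/(γ+2)) t ∂_t - (2γ/(γ+2)) (1 + u/γ) ∂_u`. -/
def Z (γ : ℝ) : SmoothVF :=
  ⟨fun p => ((γ - 2) / (γ + 2) * p.1, 0, -(2 * γ / (γ + 2) * (1 + p.2.2 / γ))), by
    change ContDiff ℝ ∞ _; fun_prop⟩

/-- `Y = ((γ-2)/(γ+2)) (t²/2) ∂_t - (2γt/(γ+2)) (1 + u/γ) ∂_u`. -/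
def Y (γ : ℝ) : SmoothVF :=
  ⟨fun p => ((γ - 2) / (γ + 2) * (p.1 ^ 2 / 2), 0,
      -(2 * γ * p.1 / (γ + 2) * (1 + p.2.2 / γ))), by
    change ContDiff ℝ ∞ _; fun_prop⟩

/-- `X_1 = X_1^0 + ε [((γ-2)/(γ+2)) (t²/2) ∂_t - (2γt/(γ+2)) (1 + u/γ) ∂_u]`. -/
def X1 (γ ε : ℝ) : SmoothVF := X10 + ε • Y γ

/-! ### Commutation relations -/

/-- The commutation relations between `X_1, X_2, X_3, X_4, Z, Y`, for elements of an
arbitrary real Lie algebra. -/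
structure CommRel (γ ε : ℝ) {L : Type*} [LieRing L] [LieAlgebra ℝ L]
    (x₁ x₂ x₃ x₄ z y : L) : Prop where
  x2_x1 : ⁅x₂, x₁⁆ = x₂ + ε • z
  x2_x4 : ⁅x₂, x₄⁆ = 0
  x2_x3 : ⁅x₂, x₃⁆ = 0
  x1_x4 : ⁅x₁, x₄⁆ = 0
  x1_x3 : ⁅x₁, x₃⁆ = -x₃
  x3_x4 : ⁅x₃, x₄⁆ = x₃
  x1_z : ⁅x₁, z⁆ = -(ε * ((γ - 2) / (γ + 2))) • y
  x1_y : ⁅x₁, y⁆ = y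
  x2_y : ⁅x₂, y⁆ = z
  x2_z : ⁅x₂, z⁆ = ((γ - 2) / (γ + 2)) • x₂
  z_y : ⁅z, y⁆ = ((γ - 2) / (γ + 2)) • y
  x3_y : ⁅x₃, y⁆ = 0
  x3_z : ⁅x₃, z⁆ = 0
  x4_y : ⁅x₄, y⁆ = 0
  x4_z : ⁅x₄, z⁆ = 0

/-- The linear span of `S` is closed under the bracket. -/
def SpansSubalgebra {L : Type*} [LieRing L] [LieAlgebra ℝ L] (S : Set L) : Prop :=
  ∃ A : LieSubalgebra ℝ L, A.toSubmodule = Submodule.span ℝ S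

/-- The linear span of `S` is a Lie subalgebra isomorphic to `sl(2, ℝ)`. -/
def SpansSl2 {L : Type*} [LieRing L] [LieAlgebra ℝ L] (S : Set L) : Prop :=
  ∃ A : LieSubalgebra ℝ L, A.toSubmodule = Submodule.span ℝ S ∧
    Nonempty (A ≃ₗ⁅ℝ⁆ LieAlgebra.SpecialLinear.sl (Fin 2) ℝ)

end BinomialWave

end

/-! Write κ = (γ-2)/(γ+2) and let `K1`, `K2`, `K3` be the derivatives of (1+u/γ)^(γ-1). The
nonlinearity enters through its power law: multiplying `K2` or `K3` by the base 1+u/γ returns a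
constant multiple of the preceding derivative.

Sufficiency. For fields quadratic in t and affine in x and u, subject to one balance relation, the
prolongation applied to F is a multiple of F plus an explicit remainder (`prolongApply_polyField`).
In the general approximate generator the t² term is weighted by κ exactly so that the order-ε part
of this remainder cancels, leaving O(ε²) on convergent jets.

Necessity. Replacing u_tt by u_tt - ε u_t turns any jet of the unperturbed equation into a family
solving the perturbed one exactly. Along such families V₀ is seen to be an exact symmetry at ε = 0.
The determining equations force τ and ξ to be functions of t and x alone, then τ_x = ξ_t = 0, then
(γ+2) τ_tt = 0 and (3γ-2) ξ_xx = 0; here γ ≠ -2 and γ ≠ 2/3 leave four constants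
(`exists_eq_polyField_of_isSymmetry`). Each such V₀ has a known completion to an approximate
symmetry. Two completions differ by εW, and dividing by ε shows that W is exact
(`IsApproxSymmetry.isSymmetry_of_add`), so V₁ contributes four further constants.

Lie algebra. All operators are fields of the same polynomial type, so their brackets are computed
from coefficients. The triple X₂, Z, Y is a rescaled standard sl(2) basis. The six operators are
linearly dependent, since X₁ = X₄ + κ⁻¹Z + εY; the abstract algebra is obtained by giving X₁ an
additional component that no bracket sees (`exists_realization`). -/

open scoped ContDiff Topology

noncomputable section

namespace BinomialWave

section

/-! ### The equation in explicit form -/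

/-- First derivative of `(1 + u/γ)^(γ-1)`. -/
def K1 (γ u : ℝ) : ℝ := (γ - 1) / γ * (1 + u / γ) ^ (γ - 2)

/-- Second derivative of `(1 + u/γ)^(γ-1)`. -/
def K2 (γ u : ℝ) : ℝ := (γ - 1) * (γ - 2) / γ ^ 2 * (1 + u / γ) ^ (γ - 3)

/-- Third derivative of `(1 + u/γ)^(γ-1)`. -/
def K3 (γ u : ℝ) : ℝ := (γ - 1) * (γ - 2) * (γ - 3) / γ ^ 3 * (1 + u / γ) ^ (γ - 4)

theorem hasDerivAt_base_rpow {γ u : ℝ} (hu : 0 < 1 + u / γ) (a : ℝ) :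
    HasDerivAt (fun u => (1 + u / γ) ^ a) (a / γ * (1 + u / γ) ^ (a - 1)) u := by
  have h : HasDerivAt (fun u : ℝ => 1 + u / γ) (1 / γ) u :=
    ((hasDerivAt_id u).div_const γ).const_add 1
  convert h.rpow_const (p := a) (Or.inl hu.ne') using 1
  ring

theorem hasDerivAt_pow {γ u : ℝ} (hu : 0 < 1 + u / γ) :
    HasDerivAt (fun u => (1 + u / γ) ^ (γ - 1)) (K1 γ u) u := by
  convert hasDerivAt_base_rpow hu (γ - 1) using 1
  rw [K1]; ring_nf

theorem hasDerivAt_K1 {γ u : ℝ} (hu : 0 < 1 + u / γ) :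
    HasDerivAt (K1 γ) (K2 γ u) u := by
  refine ((hasDerivAt_base_rpow hu (γ - 2)).const_mul ((γ - 1) / γ)).congr_deriv ?_
  rw [K2, show γ - 2 - 1 = γ - 3 by ring]; ring

theorem hasDerivAt_K2 {γ u : ℝ} (hu : 0 < 1 + u / γ) :
    HasDerivAt (K2 γ) (K3 γ u) u := by
  refine ((hasDerivAt_base_rpow hu (γ - 3)).const_mul
    ((γ - 1) * (γ - 2) / γ ^ 2)).congr_deriv ?_
  rw [K3, show γ - 3 - 1 = γ - 4 by ring]; ring

/-- The power law in differential form. It fixes the dependence of η on u in the classification and,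
with the analogue for `K3`, reduces sufficiency to an identity linear in `K1` and `K2`. -/
theorem K2_mul_base {γ u : ℝ} (hu : 0 < 1 + u / γ) :
    K2 γ u * (1 + u / γ) = (γ - 2) / γ * K1 γ u := by
  have h := Real.rpow_add_one hu.ne' (γ - 3)
  rw [show γ - 3 + 1 = γ - 2 by ring] at h
  rw [K1, K2, h]; ring

theorem K3_mul_base {γ u : ℝ} (hu : 0 < 1 + u / γ) :
    K3 γ u * (1 + u / γ) = (γ - 3) / γ * K2 γ u := by
  have h := Real.rpow_add_one hu.ne' (γ - 4)
  rw [show γ - 4 + 1 = γ - 3 by ring] at h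
  rw [K2, K3, h]; ring

theorem K1_ne_zero {γ u : ℝ} (h0 : γ ≠ 0) (h1 : γ ≠ 1) (hu : 0 < 1 + u / γ) : K1 γ u ≠ 0 :=
  mul_ne_zero (div_ne_zero (sub_ne_zero.2 h1) h0) (Real.rpow_pos_of_pos hu _).ne'

theorem K2_ne_zero {γ u : ℝ} (h0 : γ ≠ 0) (h1 : γ ≠ 1) (h2 : γ ≠ 2) (hu : 0 < 1 + u / γ) :
    K2 γ u ≠ 0 :=
  mul_ne_zero (div_ne_zero (mul_ne_zero (sub_ne_zero.2 h1) (sub_ne_zero.2 h2))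
    (pow_ne_zero 2 h0)) (Real.rpow_pos_of_pos hu _).ne'

theorem isOpen_posRegion (γ : ℝ) : IsOpen (posRegion γ) :=
  isOpen_lt continuous_const (by fun_prop)

theorem hasFDerivAt_comp_u {g : ℝ → ℝ} {g' : ℝ} {p : J0} (h : HasDerivAt g g' p.2.2) :
    HasFDerivAt (fun p : J0 => g p.2.2)
      (g' • ((ContinuousLinearMap.snd ℝ ℝ ℝ).comp (ContinuousLinearMap.snd ℝ ℝ (ℝ × ℝ)))) p :=
  h.comp_hasFDerivAt p
    ((ContinuousLinearMap.snd ℝ ℝ ℝ).comp (ContinuousLinearMap.snd ℝ ℝ (ℝ × ℝ))).hasFDerivAt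

theorem Dx0_pow {γ : ℝ} {j : J1} (hj : j.1 ∈ posRegion γ) :
    Dx0 (fun p => (1 + p.2.2 / γ) ^ (γ - 1)) j = K1 γ j.1.2.2 * j.2.2 := by
  have := (hasFDerivAt_comp_u (p := j.1) (hasDerivAt_pow (γ := γ) hj)).fderiv
  simp only [Dx0, this]
  simp

theorem F0_eq {γ : ℝ} {j : J2} (hj : j.1.1 ∈ posRegion γ) :
    F0 γ j = j.2.1 - (K1 γ j.1.1.2.2 * j.2.2.2 + K2 γ j.1.1.2.2 * j.1.2.2 ^ 2) := by
  -- The derivative formula needs a positive base, which persists near the jet; the outer total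
  -- derivative only sees this germ.
  have hev : Dx0 (fun p => (1 + p.2.2 / γ) ^ (γ - 1)) =ᶠ[𝓝 j.1]
      fun i : J1 => K1 γ i.1.2.2 * i.2.2 := by
    have : ∀ᶠ i : J1 in 𝓝 j.1, i.1 ∈ posRegion γ :=
      continuous_fst.continuousAt.eventually ((isOpen_posRegion γ).mem_nhds hj)
    filter_upwards [this] with i hi using Dx0_pow hi
  have h1 : HasFDerivAt (fun i : J1 => K1 γ i.1.2.2) _ j.1 :=
    (hasFDerivAt_comp_u (p := j.1.1) (hasDerivAt_K1 (γ := γ) hj)).comp j.1 hasFDerivAt_fst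
  have h2 : HasFDerivAt (fun i : J1 => i.2.2) _ j.1 :=
    ((ContinuousLinearMap.snd ℝ ℝ ℝ).comp (ContinuousLinearMap.snd ℝ J0 (ℝ × ℝ))).hasFDerivAt
  have h : HasFDerivAt (fun i : J1 => K1 γ i.1.2.2 * i.2.2) _ j.1 := h1.mul h2
  rw [F0, Dx1, hev.fderiv_eq, h.fderiv]
  simp
  ring

theorem F_eq {γ : ℝ} (ε : ℝ) {j : J2} (hj : j.1.1 ∈ posRegion γ) :
    F γ ε j = j.2.1 - (K1 γ j.1.1.2.2 * j.2.2.2 + K2 γ j.1.1.2.2 * j.1.2.2 ^ 2)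
      + ε * j.1.2.1 := by
  rw [F, F0_eq hj, F1]

theorem fderiv_F {γ : ℝ} (ε : ℝ) {j : J2} (hj : j.1.1 ∈ posRegion γ) (v : J2) :
    fderiv ℝ (F γ ε) j v =
      v.2.1 - (K1 γ j.1.1.2.2 * v.2.2.2 + K2 γ j.1.1.2.2 * v.1.1.2.2 * j.2.2.2
        + 2 * K2 γ j.1.1.2.2 * j.1.2.2 * v.1.2.2
        + K3 γ j.1.1.2.2 * v.1.1.2.2 * j.1.2.2 ^ 2) + ε * v.1.2.1 := by
  have hev : F γ ε =ᶠ[𝓝 j] fun j : J2 =>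
      j.2.1 - (K1 γ j.1.1.2.2 * j.2.2.2 + K2 γ j.1.1.2.2 * j.1.2.2 ^ 2) + ε * j.1.2.1 := by
    have hc : ContinuousAt (fun i : J2 => i.1.1) j := by fun_prop
    filter_upwards [hc.eventually ((isOpen_posRegion γ).mem_nhds hj)] with i hi using F_eq ε hi
  have hb : HasFDerivAt (fun i : J2 => i.1.1) _ j :=
    ((ContinuousLinearMap.fst ℝ J0 (ℝ × ℝ)).comp
      (ContinuousLinearMap.fst ℝ J1 (ℝ × ℝ × ℝ))).hasFDerivAt
  have hp : HasFDerivAt (fun i : J2 => i.1.2.1) _ j :=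
    ((ContinuousLinearMap.fst ℝ ℝ ℝ).comp ((ContinuousLinearMap.snd ℝ J0 (ℝ × ℝ)).comp
      (ContinuousLinearMap.fst ℝ J1 (ℝ × ℝ × ℝ)))).hasFDerivAt
  have hq : HasFDerivAt (fun i : J2 => i.1.2.2) _ j :=
    ((ContinuousLinearMap.snd ℝ ℝ ℝ).comp ((ContinuousLinearMap.snd ℝ J0 (ℝ × ℝ)).comp
      (ContinuousLinearMap.fst ℝ J1 (ℝ × ℝ × ℝ)))).hasFDerivAt
  have htt : HasFDerivAt (fun i : J2 => i.2.1) _ j :=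
    ((ContinuousLinearMap.fst ℝ ℝ (ℝ × ℝ)).comp
      (ContinuousLinearMap.snd ℝ J1 (ℝ × ℝ × ℝ))).hasFDerivAt
  have hxx : HasFDerivAt (fun i : J2 => i.2.2.2) _ j :=
    ((ContinuousLinearMap.snd ℝ ℝ ℝ).comp ((ContinuousLinearMap.snd ℝ ℝ (ℝ × ℝ)).comp
      (ContinuousLinearMap.snd ℝ J1 (ℝ × ℝ × ℝ)))).hasFDerivAt
  have h1 : HasFDerivAt (fun i : J2 => K1 γ i.1.1.2.2) _ j :=
    HasFDerivAt.comp (g := fun p : J0 => K1 γ p.2.2) j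
      (hasFDerivAt_comp_u (p := j.1.1) (hasDerivAt_K1 (γ := γ) hj)) hb
  have h2 : HasFDerivAt (fun i : J2 => K2 γ i.1.1.2.2) _ j :=
    HasFDerivAt.comp (g := fun p : J0 => K2 γ p.2.2) j
      (hasFDerivAt_comp_u (p := j.1.1) (hasDerivAt_K2 (γ := γ) hj)) hb
  have h : HasFDerivAt (fun j : J2 => j.2.1 - (K1 γ j.1.1.2.2 * j.2.2.2
      + K2 γ j.1.1.2.2 * j.1.2.2 ^ 2) + ε * j.1.2.1) _ j :=
    (htt.sub ((h1.mul hxx).add (h2.mul (hq.pow 2)))).add (hp.const_mul ε)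
  rw [hev.fderiv_eq, h.fderiv]
  simp
  ring

/-! ### The prolongation in explicit form -/

theorem hasFDerivAt_Dt0 {f : J0 → ℝ} {j : J1} (hf : DifferentiableAt ℝ (fderiv ℝ f) j.1) :
    ∃ L : J1 →L[ℝ] ℝ, HasFDerivAt (Dt0 f) L j ∧ ∀ v : J1, L v =
      fderiv ℝ (fderiv ℝ f) j.1 v.1 (1, 0, j.2.1) + fderiv ℝ f j.1 (0, 0, v.2.1) := by
  have h1 : HasFDerivAt (fun i : J1 => fderiv ℝ f i.1) _ j :=
    hf.hasFDerivAt.comp j hasFDerivAt_fst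
  have h2 : HasFDerivAt (fun i : J1 => ((1 : ℝ), (0 : ℝ), i.2.1)) _ j :=
    (hasFDerivAt_const (1 : ℝ) j).prodMk ((hasFDerivAt_const (0 : ℝ) j).prodMk
      ((ContinuousLinearMap.fst ℝ ℝ ℝ).comp
        (ContinuousLinearMap.snd ℝ J0 (ℝ × ℝ))).hasFDerivAt)
  refine ⟨_, h1.clm_apply h2, fun v => ?_⟩
  simp
  ring

theorem hasFDerivAt_Dx0 {f : J0 → ℝ} {j : J1} (hf : DifferentiableAt ℝ (fderiv ℝ f) j.1) :
    ∃ L : J1 →L[ℝ] ℝ, HasFDerivAt (Dx0 f) L j ∧ ∀ v : J1, L v =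
      fderiv ℝ (fderiv ℝ f) j.1 v.1 (0, 1, j.2.2) + fderiv ℝ f j.1 (0, 0, v.2.2) := by
  have h1 : HasFDerivAt (fun i : J1 => fderiv ℝ f i.1) _ j :=
    hf.hasFDerivAt.comp j hasFDerivAt_fst
  have h2 : HasFDerivAt (fun i : J1 => ((0 : ℝ), (1 : ℝ), i.2.2)) _ j :=
    (hasFDerivAt_const (0 : ℝ) j).prodMk ((hasFDerivAt_const (1 : ℝ) j).prodMk
      ((ContinuousLinearMap.snd ℝ ℝ ℝ).comp
        (ContinuousLinearMap.snd ℝ J0 (ℝ × ℝ))).hasFDerivAt)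
  refine ⟨_, h1.clm_apply h2, fun v => ?_⟩
  simp
  ring

theorem hasFDerivAt_ut (j : J1) : HasFDerivAt (fun i : J1 => i.2.1)
    ((ContinuousLinearMap.fst ℝ ℝ ℝ).comp (ContinuousLinearMap.snd ℝ J0 (ℝ × ℝ))) j :=
  ((ContinuousLinearMap.fst ℝ ℝ ℝ).comp (ContinuousLinearMap.snd ℝ J0 (ℝ × ℝ))).hasFDerivAt

theorem hasFDerivAt_ux (j : J1) : HasFDerivAt (fun i : J1 => i.2.2)
    ((ContinuousLinearMap.snd ℝ ℝ ℝ).comp (ContinuousLinearMap.snd ℝ J0 (ℝ × ℝ))) j :=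
  ((ContinuousLinearMap.snd ℝ ℝ ℝ).comp (ContinuousLinearMap.snd ℝ J0 (ℝ × ℝ))).hasFDerivAt

theorem differentiableAt_fderiv {f : J0 → ℝ} {p : J0} (hf : ContDiffAt ℝ 2 f p) :
    DifferentiableAt ℝ (fderiv ℝ f) p :=
  (hf.fderiv_right (m := 1) (by norm_num)).differentiableAt (by norm_num)

variable {V : J0 → J0} {j : J2}

theorem etaTT_eq (hτ : ContDiffAt ℝ 2 (fun p => (V p).1) j.1.1)
    (hξ : ContDiffAt ℝ 2 (fun p => (V p).2.1) j.1.1)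
    (hη : ContDiffAt ℝ 2 (fun p => (V p).2.2) j.1.1) :
    etaTT V j =
      fderiv ℝ (fderiv ℝ fun p => (V p).2.2) j.1.1 (1, 0, j.1.2.1) (1, 0, j.1.2.1)
      - j.1.2.1 * fderiv ℝ (fderiv ℝ fun p => (V p).1) j.1.1 (1, 0, j.1.2.1) (1, 0, j.1.2.1)
      - j.1.2.2 * fderiv ℝ (fderiv ℝ fun p => (V p).2.1) j.1.1 (1, 0, j.1.2.1) (1, 0, j.1.2.1)
      + fderiv ℝ (fun p => (V p).2.2) j.1.1 (0, 0, j.2.1)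
      - j.1.2.1 * fderiv ℝ (fun p => (V p).1) j.1.1 (0, 0, j.2.1)
      - j.1.2.2 * fderiv ℝ (fun p => (V p).2.1) j.1.1 (0, 0, j.2.1)
      - 2 * j.2.1 * fderiv ℝ (fun p => (V p).1) j.1.1 (1, 0, j.1.2.1)
      - 2 * j.2.2.1 * fderiv ℝ (fun p => (V p).2.1) j.1.1 (1, 0, j.1.2.1) := by
  obtain ⟨A, hA, hA'⟩ := hasFDerivAt_Dt0 (j := j.1) (differentiableAt_fderiv hτ)
  obtain ⟨B, hB, hB'⟩ := hasFDerivAt_Dt0 (j := j.1) (differentiableAt_fderiv hξ)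
  obtain ⟨C, hC, hC'⟩ := hasFDerivAt_Dt0 (j := j.1) (differentiableAt_fderiv hη)
  have h : HasFDerivAt (etaT V) _ j.1 :=
    (hC.sub ((hasFDerivAt_ut j.1).mul hA)).sub ((hasFDerivAt_ux j.1).mul hB)
  rw [etaTT, Dt1, h.fderiv]
  simp [hA', hB', hC']
  simp only [Dt0]
  ring

theorem etaXX_eq (hτ : ContDiffAt ℝ 2 (fun p => (V p).1) j.1.1)
    (hξ : ContDiffAt ℝ 2 (fun p => (V p).2.1) j.1.1)
    (hη : ContDiffAt ℝ 2 (fun p => (V p).2.2) j.1.1) :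
    etaXX V j =
      fderiv ℝ (fderiv ℝ fun p => (V p).2.2) j.1.1 (0, 1, j.1.2.2) (0, 1, j.1.2.2)
      - j.1.2.1 * fderiv ℝ (fderiv ℝ fun p => (V p).1) j.1.1 (0, 1, j.1.2.2) (0, 1, j.1.2.2)
      - j.1.2.2 * fderiv ℝ (fderiv ℝ fun p => (V p).2.1) j.1.1 (0, 1, j.1.2.2) (0, 1, j.1.2.2)
      + fderiv ℝ (fun p => (V p).2.2) j.1.1 (0, 0, j.2.2.2)
      - j.1.2.1 * fderiv ℝ (fun p => (V p).1) j.1.1 (0, 0, j.2.2.2)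
      - j.1.2.2 * fderiv ℝ (fun p => (V p).2.1) j.1.1 (0, 0, j.2.2.2)
      - 2 * j.2.2.1 * fderiv ℝ (fun p => (V p).1) j.1.1 (0, 1, j.1.2.2)
      - 2 * j.2.2.2 * fderiv ℝ (fun p => (V p).2.1) j.1.1 (0, 1, j.1.2.2) := by
  obtain ⟨A, hA, hA'⟩ := hasFDerivAt_Dx0 (j := j.1) (differentiableAt_fderiv hτ)
  obtain ⟨B, hB, hB'⟩ := hasFDerivAt_Dx0 (j := j.1) (differentiableAt_fderiv hξ)
  obtain ⟨C, hC, hC'⟩ := hasFDerivAt_Dx0 (j := j.1) (differentiableAt_fderiv hη)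
  have h : HasFDerivAt (etaX V) _ j.1 :=
    (hC.sub ((hasFDerivAt_ut j.1).mul hA)).sub ((hasFDerivAt_ux j.1).mul hB)
  rw [etaXX, Dx1, h.fderiv]
  simp [hA', hB', hC']
  simp only [Dx0]
  ring

end

/-! ### Locality and linearity of the prolonged action -/

theorem prolongApply_F_eq {γ : ℝ} (ε : ℝ) (V : J0 → J0) {j : J2} (hj : j.1.1 ∈ posRegion γ) :
    prolongApply V (F γ ε) j =
      etaTT V j - (K1 γ j.1.1.2.2 * etaXX V j + K2 γ j.1.1.2.2 * (V j.1.1).2.2 * j.2.2.2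
        + 2 * K2 γ j.1.1.2.2 * j.1.2.2 * etaX V j.1
        + K3 γ j.1.1.2.2 * (V j.1.1).2.2 * j.1.2.2 ^ 2) + ε * etaT V j.1 := by
  rw [prolongApply, fderiv_F ε hj]
  rfl

/-- The prolongation depends only on the germ of the field, so fields known only on the open set D
can be exchanged for global polynomial ones. -/
theorem prolongApply_congr {V W : J0 → J0} {j : J2} (h : V =ᶠ[𝓝 j.1.1] W) (G : J2 → ℝ) :
    prolongApply V G j = prolongApply W G j := by
  have e1 : (fun p => (V p).1) =ᶠ[𝓝 j.1.1] fun p => (W p).1 := h.fun_comp Prod.fst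
  have e2 : (fun p => (V p).2.1) =ᶠ[𝓝 j.1.1] fun p => (W p).2.1 := h.fun_comp fun x => x.2.1
  have e3 : (fun p => (V p).2.2) =ᶠ[𝓝 j.1.1] fun p => (W p).2.2 := h.fun_comp fun x => x.2.2
  have hc : Filter.Tendsto (fun i : J1 => i.1) (𝓝 j.1) (𝓝 j.1.1) := continuous_fst.continuousAt
  have hT : etaT V =ᶠ[𝓝 j.1] etaT W := by
    filter_upwards [hc.eventually e1.eventuallyEq_nhds, hc.eventually e2.eventuallyEq_nhds,
      hc.eventually e3.eventuallyEq_nhds] with i h1 h2 h3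
    simp only [etaT, Dt0, h1.fderiv_eq, h2.fderiv_eq, h3.fderiv_eq]
  have hX : etaX V =ᶠ[𝓝 j.1] etaX W := by
    filter_upwards [hc.eventually e1.eventuallyEq_nhds, hc.eventually e2.eventuallyEq_nhds,
      hc.eventually e3.eventuallyEq_nhds] with i h1 h2 h3
    simp only [etaX, Dx0, h1.fderiv_eq, h2.fderiv_eq, h3.fderiv_eq]
  simp only [prolongApply, prolong, etaTT, etaTX, etaXX, Dt1, Dx1, Dt0, Dx0, hT.fderiv_eq,
    hX.fderiv_eq, hT.eq_of_nhds, hX.eq_of_nhds, e1.fderiv_eq, e2.fderiv_eq,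
    h.eq_of_nhds]

theorem fderiv_add_mul {f g : J0 → ℝ} {p : J0} (c : ℝ) (hf : ContDiffAt ℝ 2 f p)
    (hg : ContDiffAt ℝ 2 g p) :
    fderiv ℝ (fun p => f p + c * g p) p = fderiv ℝ f p + c • fderiv ℝ g p :=
  ((hf.differentiableAt (by norm_num)).hasFDerivAt.add
    ((hg.differentiableAt (by norm_num)).hasFDerivAt.const_mul c)).fderiv

theorem fderiv_fderiv_add_mul {f g : J0 → ℝ} {p : J0} (c : ℝ) (hf : ContDiffAt ℝ 2 f p)
    (hg : ContDiffAt ℝ 2 g p) :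
    fderiv ℝ (fderiv ℝ fun p => f p + c * g p) p =
      fderiv ℝ (fderiv ℝ f) p + c • fderiv ℝ (fderiv ℝ g) p := by
  have h : (fderiv ℝ fun p => f p + c * g p) =ᶠ[𝓝 p]
      fun p => fderiv ℝ f p + c • fderiv ℝ g p := by
    filter_upwards [hf.eventually (by simp), hg.eventually (by simp)] with q h1 h2
      using fderiv_add_mul c h1 h2
  rw [h.fderiv_eq]
  exact ((differentiableAt_fderiv hf).hasFDerivAt.add
    ((differentiableAt_fderiv hg).hasFDerivAt.const_smul c)).fderiv

/-- Linearity in the field allows two approximate symmetries with the same leading part to be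
subtracted. -/
theorem prolongApply_F_add_smul {γ : ℝ} (ε c : ℝ) {V W : J0 → J0} {j : J2}
    (hj : j.1.1 ∈ posRegion γ) (hV : ContDiffAt ℝ 2 V j.1.1) (hW : ContDiffAt ℝ 2 W j.1.1) :
    prolongApply (fun p => V p + c • W p) (F γ ε) j =
      prolongApply V (F γ ε) j + c * prolongApply W (F γ ε) j := by
  have hU : ContDiffAt ℝ 2 (fun p => V p + c • W p) j.1.1 := hV.add (hW.const_smul c)
  rw [prolongApply_F_eq ε _ hj, prolongApply_F_eq ε _ hj, prolongApply_F_eq ε _ hj,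
    etaTT_eq hV.fst hV.snd.fst hV.snd.snd, etaTT_eq hW.fst hW.snd.fst hW.snd.snd,
    etaTT_eq hU.fst hU.snd.fst hU.snd.snd, etaXX_eq hV.fst hV.snd.fst hV.snd.snd,
    etaXX_eq hW.fst hW.snd.fst hW.snd.snd, etaXX_eq hU.fst hU.snd.fst hU.snd.snd]
  simp only [etaT, etaX, Dt0, Dx0, Prod.fst_add, Prod.snd_add, Prod.smul_fst, Prod.smul_snd,
    smul_eq_mul, fderiv_add_mul c hV.fst hW.fst, fderiv_add_mul c hV.snd.fst hW.snd.fst,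
    fderiv_add_mul c hV.snd.snd hW.snd.snd, fderiv_fderiv_add_mul c hV.fst hW.fst,
    fderiv_fderiv_add_mul c hV.snd.fst hW.snd.fst, fderiv_fderiv_add_mul c hV.snd.snd hW.snd.snd,
    add_apply, smul_apply]
  ring

/-! ### Vector fields quadratic in `t` and affine in `x` and `u` -/

/-- The vector field `(a t²/2 + b t + c) ∂_t + (d x + e) ∂_x + (g + h t) (1 + u/γ) ∂_u`. -/
def polyField (γ a b c d e g h : ℝ) (p : J0) : J0 :=
  (a * (p.1 ^ 2 / 2) + b * p.1 + c, d * p.2.1 + e, (g + h * p.1) * (1 + p.2.2 / γ))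

theorem contDiff_polyField (γ a b c d e g h : ℝ) {n : WithTop ℕ∞} :
    ContDiff ℝ n (polyField γ a b c d e g h) := by
  unfold polyField; fun_prop

/-- The coordinate `t` as a linear form. -/
abbrev coordT : J0 →L[ℝ] ℝ := ContinuousLinearMap.fst ℝ ℝ (ℝ × ℝ)

/-- The coordinate `x` as a linear form. -/
abbrev coordX : J0 →L[ℝ] ℝ :=
  (ContinuousLinearMap.fst ℝ ℝ ℝ).comp (ContinuousLinearMap.snd ℝ ℝ (ℝ × ℝ))

/-- The coordinate `u` as a linear form. -/
abbrev coordU : J0 →L[ℝ] ℝ :=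
  (ContinuousLinearMap.snd ℝ ℝ ℝ).comp (ContinuousLinearMap.snd ℝ ℝ (ℝ × ℝ))

theorem hasFDerivAt_t (p : J0) : HasFDerivAt (fun p : J0 => p.1) coordT p := coordT.hasFDerivAt

theorem hasFDerivAt_x (p : J0) : HasFDerivAt (fun p : J0 => p.2.1) coordX p :=
  coordX.hasFDerivAt

theorem hasFDerivAt_u (p : J0) : HasFDerivAt (fun p : J0 => p.2.2) coordU p :=
  coordU.hasFDerivAt

theorem hasFDerivAt_base (γ : ℝ) (p : J0) :
    HasFDerivAt (fun p : J0 => 1 + p.2.2 / γ) (γ⁻¹ • coordU) p := by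
  simpa only [div_eq_inv_mul] using ((hasFDerivAt_u p).const_mul γ⁻¹).const_add 1

theorem fderiv_polyField_fst (a b c : ℝ) :
    (fderiv ℝ fun p : J0 => a * (p.1 ^ 2 / 2) + b * p.1 + c) =
      fun p => (a * p.1 + b) • coordT := by
  funext p
  have h : HasFDerivAt (fun p : J0 => a * (p.1 ^ 2 / 2) + b * p.1 + c) _ p :=
    (((((hasFDerivAt_t p).pow 2).mul_const (2 : ℝ)⁻¹).const_mul a).add
      ((hasFDerivAt_t p).const_mul b)).add_const c
  rw [h.fderiv]
  ext <;> simp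

theorem fderiv_polyField_snd (d e : ℝ) :
    (fderiv ℝ fun p : J0 => d * p.2.1 + e) = fun _ => d • coordX := by
  funext p
  exact (((hasFDerivAt_x p).const_mul d).add_const e).fderiv

theorem fderiv_polyField_trd (γ g h : ℝ) :
    (fderiv ℝ fun p : J0 => (g + h * p.1) * (1 + p.2.2 / γ)) =
      fun p => (h * (1 + p.2.2 / γ)) • coordT + ((g + h * p.1) / γ) • coordU := by
  funext p
  have h : HasFDerivAt (fun p : J0 => (g + h * p.1) * (1 + p.2.2 / γ)) _ p :=
    (((hasFDerivAt_t p).const_mul h).const_add g).mul (hasFDerivAt_base γ p)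
  rw [h.fderiv]
  ext <;> simp <;> ring

theorem fderiv_fderiv_polyField_fst (a b c : ℝ) (p v w : J0) :
    fderiv ℝ (fderiv ℝ fun p : J0 => a * (p.1 ^ 2 / 2) + b * p.1 + c) p v w =
      a * v.1 * w.1 := by
  rw [fderiv_polyField_fst]
  have h : HasFDerivAt (fun p : J0 => (a * p.1 + b) • coordT) _ p :=
    (((hasFDerivAt_t p).const_mul a).add_const b).smul_const coordT
  rw [h.fderiv]
  simp

theorem fderiv_fderiv_polyField_snd (d e : ℝ) (p v w : J0) :
    fderiv ℝ (fderiv ℝ fun p : J0 => d * p.2.1 + e) p v w = 0 := by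
  rw [fderiv_polyField_snd]
  simp

theorem fderiv_fderiv_polyField_trd (γ g h : ℝ) (p v w : J0) :
    fderiv ℝ (fderiv ℝ fun p : J0 => (g + h * p.1) * (1 + p.2.2 / γ)) p v w =
      h / γ * (v.2.2 * w.1 + v.1 * w.2.2) := by
  rw [fderiv_polyField_trd]
  have h : HasFDerivAt (fun p : J0 =>
      (h * (1 + p.2.2 / γ)) • coordT + ((g + h * p.1) / γ) • coordU) _ p :=
    (((hasFDerivAt_base γ p).const_mul h).smul_const coordT).add
      (((((hasFDerivAt_t p).const_mul h).const_add g).mul_const γ⁻¹).smul_const coordU)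
  rw [h.fderiv]
  simp
  ring

/-- The hypothesis `hbal` is the determining relation K2 η = 2 K1 (ξ_x - τ_t) for this family, after
the power law. It makes the u_xx and u_x² terms assemble into a multiple of F. What remains comes
from the t-dependence of the coefficients and from the term ε u_t. -/
theorem prolongApply_polyField {γ : ℝ} (h0 : γ ≠ 0) (ε a b c d e g h : ℝ) {j : J2}
    (hj : j.1.1 ∈ posRegion γ)
    (hbal : (γ - 2) * (g + h * j.1.1.1) = 2 * γ * (d - (a * j.1.1.1 + b))) :
    prolongApply (polyField γ a b c d e g h) (F γ ε) j =
      ((g + h * j.1.1.1) / γ - 2 * (a * j.1.1.1 + b)) * F γ ε j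
      + j.1.2.1 * (2 * h / γ - a)
      + ε * (h * (1 + j.1.1.2.2 / γ) + j.1.2.1 * (a * j.1.1.1 + b)) := by
  have hV := (contDiff_polyField γ a b c d e g h (n := 2)).contDiffAt (x := j.1.1)
  rw [prolongApply_F_eq ε _ hj, etaTT_eq hV.fst hV.snd.fst hV.snd.snd,
    etaXX_eq hV.fst hV.snd.fst hV.snd.snd, F_eq ε hj]
  simp only [etaT, etaX, Dt0, Dx0, polyField, fderiv_fderiv_polyField_fst,
    fderiv_fderiv_polyField_snd, fderiv_fderiv_polyField_trd]
  simp only [fderiv_polyField_fst, fderiv_polyField_snd, fderiv_polyField_trd]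
  have e2 := K2_mul_base (γ := γ) hj
  have e3 := K3_mul_base (γ := γ) hj
  simp only [add_apply, smul_apply, ContinuousLinearMap.comp_apply,
    ContinuousLinearMap.coe_fst', ContinuousLinearMap.coe_snd', smul_eq_mul]
  generalize K1 γ j.1.1.2.2 = k1 at *
  generalize K2 γ j.1.1.2.2 = k2 at *
  generalize K3 γ j.1.1.2.2 = k3 at *
  obtain ⟨⟨⟨t, x, u⟩, p, q⟩, utt, s, r⟩ := j
  simp only at *
  have e2' : k2 * ((g + h * t) * (1 + u / γ)) = (g + h * t) * ((γ - 2) / γ * k1) := by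
    rw [← e2]; ring
  have e3' : k3 * ((g + h * t) * (1 + u / γ)) = (g + h * t) * ((γ - 3) / γ * k2) := by
    rw [← e3]; ring
  rw [e2', e3']
  have hb' : (γ - 2) / γ * (g + h * t) = 2 * (d - (a * t + b)) := by
    field_simp
    linear_combination hbal
  field_simp
  field_simp at hb'
  linear_combination (-(k1 * r + k2 * q ^ 2)) * hb'

/-! ### Sufficiency: the explicit fields are symmetries -/

section

variable {γ : ℝ} {D : Set J0}

theorem generalX_eq_polyField (γ : ℝ) (c k : Fin 4 → ℝ) (ε : ℝ) :
    generalX γ c k ε = polyField γ (ε * ((γ - 2) / (γ + 2) * c 0)) (c 0 + ε * k 0)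
      (c 1 + ε * k 1) (c 0 + c 2 + ε * (k 0 + k 2)) (c 3 + ε * k 3)
      (2 * γ / (γ - 2) * (c 2 + ε * k 2))
      (-(2 * γ / (γ - 2) * (ε * ((γ - 2) / (γ + 2) * c 0)))) := by
  funext p
  simp only [generalX, polyField, Prod.mk.injEq]
  refine ⟨?_, ?_, ?_⟩ <;> ring

/-- With a and h the coefficients of `polyField` in `generalX_eq_polyField`, 2h/γ - a = -ε c₀. This
cancels the order-ε contribution of c₀ to the u_t coefficient, and h is itself of order ε, so the
remainder carries ε². -/
theorem prolongApply_generalX (h0 : γ ≠ 0) (h2 : γ ≠ 2) (h2' : γ ≠ -2) (c k : Fin 4 → ℝ)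
    (ε : ℝ) {j : J2} (hj : j.1.1 ∈ posRegion γ) :
    prolongApply (generalX γ c k ε) (F γ ε) j =
      (2 / (γ - 2) * (c 2 + ε * k 2 - ε * ((γ - 2) / (γ + 2) * c 0) * j.1.1.1)
        - 2 * (ε * ((γ - 2) / (γ + 2) * c 0) * j.1.1.1 + c 0 + ε * k 0)) * F γ ε j
      + ε * (ε * (-(2 * γ / (γ + 2) * c 0) * (1 + j.1.1.2.2 / γ)
        + j.1.2.1 * ((γ - 2) / (γ + 2) * c 0 * j.1.1.1 + k 0))) := by
  have hm : γ - 2 ≠ 0 := sub_ne_zero.2 h2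
  have hp : γ + 2 ≠ 0 := fun h => h2' (by linarith)
  rw [generalX_eq_polyField, prolongApply_polyField h0 ε _ _ _ _ _ _ _ hj]
  · field_simp
    ring
  · field_simp
    ring

theorem isApproxSymmetry_generalX (h0 : γ ≠ 0) (h2 : γ ≠ 2) (h2' : γ ≠ -2)
    (hDo : IsOpen D) (hD : D ⊆ posRegion γ) (c k : Fin 4 → ℝ) :
    IsApproxSymmetry γ D (generalX γ c k) := by
  intro j hj hj0 hF
  have hc : ContinuousAt (fun ε => (j ε).1.1) 0 := by fun_prop
  have hev : ∀ᶠ ε in 𝓝 (0 : ℝ), (j ε).1.1 ∈ D := hc.eventually (hDo.mem_nhds hj0)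
  refine Asymptotics.IsLittleO.congr' ?_
    (hev.mono fun ε h => (prolongApply_generalX h0 h2 h2' c k ε (hD h)).symm)
    Filter.EventuallyEq.rfl
  -- Along a convergent family of jets the multiplier of F is bounded and the remainder is ε times a
  -- quantity tending to 0.
  refine Asymptotics.IsLittleO.add ?_ ?_
  · have hb : ContinuousAt (fun ε : ℝ =>
        2 / (γ - 2) * (c 2 + ε * k 2 - ε * ((γ - 2) / (γ + 2) * c 0) * (j ε).1.1.1)
        - 2 * (ε * ((γ - 2) / (γ + 2) * c 0) * (j ε).1.1.1 + c 0 + ε * k 0)) 0 := by fun_prop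
    simpa using (hb.tendsto.isBigO_one ℝ).mul_isLittleO hF
  · have hb : (fun ε : ℝ => ε * (-(2 * γ / (γ + 2) * c 0) * (1 + (j ε).1.1.2.2 / γ)
        + (j ε).1.2.1 * ((γ - 2) / (γ + 2) * c 0 * (j ε).1.1.1 + k 0)))
        =o[𝓝 0] fun _ => (1 : ℝ) := by
      rw [Asymptotics.isLittleO_one_iff]
      have : ContinuousAt (fun ε : ℝ => ε * (-(2 * γ / (γ + 2) * c 0) * (1 + (j ε).1.1.2.2 / γ)
        + (j ε).1.2.1 * ((γ - 2) / (γ + 2) * c 0 * (j ε).1.1.1 + k 0))) 0 := by fun_prop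
      simpa [ContinuousAt] using this
    simpa using (Asymptotics.isBigO_refl (fun ε : ℝ => ε) (𝓝 0)).mul_isLittleO hb

theorem IsApproxSymmetry.congr {X X' : ℝ → J0 → J0} (hDo : IsOpen D)
    (h : IsApproxSymmetry γ D X) (hX : ∀ ε, ∀ p ∈ D, X ε p = X' ε p) :
    IsApproxSymmetry γ D X' := by
  intro j hj hj0 hF
  have hc : ContinuousAt (fun ε => (j ε).1.1) 0 := by fun_prop
  refine (h j hj hj0 hF).congr' ?_ Filter.EventuallyEq.rfl
  filter_upwards [hc.eventually (hDo.mem_nhds hj0)] with ε hε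
  exact prolongApply_congr
    (Filter.eventuallyEq_of_mem (hDo.mem_nhds hε) fun p hp => hX ε p hp) _

theorem IsSymmetry.congr {ε : ℝ} {V W : J0 → J0} (hDo : IsOpen D)
    (h : IsSymmetry γ ε D V) (hV : ∀ p ∈ D, V p = W p) : IsSymmetry γ ε D W := by
  intro j hj hF
  rw [← h j hj hF]
  exact (prolongApply_congr
    (Filter.eventuallyEq_of_mem (hDo.mem_nhds hj) fun p hp => hV p hp) _).symm

/-- The linear combinations of the exact generators as polynomial fields. -/
theorem exactX_eq_polyField (γ : ℝ) (c : Fin 4 → ℝ) :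
    ((c 0 • X10 + c 1 • X2 + c 2 • X3 + c 3 • X4 γ : SmoothVF) : J0 → J0) =
      polyField γ 0 (c 0) (c 1) (c 0 + c 3) (c 2) (2 * γ / (γ - 2) * c 3) 0 := by
  funext p
  simp only [polyField, X10, X2, X3, X4, Submodule.coe_add, Submodule.coe_smul, Pi.add_apply,
    Pi.smul_apply, Prod.smul_mk, Prod.mk_add_mk, smul_eq_mul, Prod.mk.injEq]
  refine ⟨?_, ?_, ?_⟩ <;> ring

theorem isSymmetry_exactX (h0 : γ ≠ 0) (h2 : γ ≠ 2) (hD : D ⊆ posRegion γ) (c : Fin 4 → ℝ) :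
    IsSymmetry γ 0 D (c 0 • X10 + c 1 • X2 + c 2 • X3 + c 3 • X4 γ : SmoothVF).1 := by
  intro j hj hF
  have hm : γ - 2 ≠ 0 := sub_ne_zero.2 h2
  rw [exactX_eq_polyField, prolongApply_polyField h0 0 _ _ _ _ _ _ _ (hD hj), hF]
  · ring
  · field_simp
    ring

theorem generalX_eq (h2 : γ ≠ 2) (c k : Fin 4 → ℝ) (ε : ℝ) : generalX γ c k ε =
    (c 0 • X1 γ ε + c 1 • X2 + c 3 • X3 + c 2 • X4 γ
      + ε • (k 0 • X10 + k 1 • X2 + k 3 • X3 + k 2 • X4 γ) : SmoothVF).1 := by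
  have hm : γ - 2 ≠ 0 := sub_ne_zero.2 h2
  funext p
  simp only [generalX, X1, X10, X2, X3, X4, Y, Submodule.coe_add, Submodule.coe_smul,
    Pi.add_apply, Pi.smul_apply, Prod.smul_mk, Prod.mk_add_mk, smul_eq_mul, Prod.mk.injEq]
  refine ⟨?_, ?_, ?_⟩
  · ring
  · ring
  · rw [show 2 * ε * (γ / (γ - 2)) * (k 2 - (γ - 2) / (γ + 2) * c 0 * p.1) =
      2 * ε * (γ / (γ - 2)) * k 2 - 2 * ε * (γ * ((γ - 2) / (γ - 2)) / (γ + 2)) * c 0 * p.1 by ring,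
      div_self hm]
    ring

end

section

/-! ### Partial derivatives -/

/-- The partial derivative with respect to `t`. -/
def pdt (f : J0 → ℝ) (p : J0) : ℝ := fderiv ℝ f p (1, 0, 0)

/-- The partial derivative with respect to `x`. -/
def pdx (f : J0 → ℝ) (p : J0) : ℝ := fderiv ℝ f p (0, 1, 0)

/-- The partial derivative with respect to `u`. -/
def pdu (f : J0 → ℝ) (p : J0) : ℝ := fderiv ℝ f p (0, 0, 1)

variable {D : Set J0} {f g : J0 → ℝ} {p : J0}

theorem fderiv_apply_eq (f : J0 → ℝ) (p : J0) (a b c : ℝ) :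
    fderiv ℝ f p (a, b, c) = a * pdt f p + b * pdx f p + c * pdu f p := by
  have : ((a, b, c) : J0) = a • (1, 0, 0) + b • (0, 1, 0) + c • (0, 0, 1) := by simp
  rw [this]
  simp only [map_add, map_smul, smul_eq_mul, pdt, pdx, pdu]

theorem fderiv_eq_pd (f : J0 → ℝ) (p : J0) :
    fderiv ℝ f p = pdt f p • coordT + pdx f p • coordX + pdu f p • coordU := by
  refine ContinuousLinearMap.ext fun v => ?_
  rw [← Prod.mk.eta (p := v), ← Prod.mk.eta (p := v.2), fderiv_apply_eq]
  simp
  ring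

theorem fderiv_fderiv_apply (hf : ContDiffAt ℝ 2 f p) (v w : J0) :
    fderiv ℝ (fderiv ℝ f) p v w = fderiv ℝ (fun p => fderiv ℝ f p w) p v := by
  have h : HasFDerivAt (fun p => fderiv ℝ f p w) _ p :=
    (differentiableAt_fderiv hf).hasFDerivAt.clm_apply (hasFDerivAt_const w p)
  rw [h.fderiv]
  simp

theorem fderiv_fderiv_comm (hf : ContDiffAt ℝ 2 f p) (v w : J0) :
    fderiv ℝ (fderiv ℝ f) p v w = fderiv ℝ (fderiv ℝ f) p w v :=
  hf.isSymmSndFDerivAt (by simp) v w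

theorem pdt_pdu_comm (hf : ContDiffAt ℝ 2 f p) : pdt (pdu f) p = pdu (pdt f) p := by
  have := fderiv_fderiv_comm hf (1, 0, 0) (0, 0, 1)
  rwa [fderiv_fderiv_apply hf, fderiv_fderiv_apply hf] at this

theorem pdx_pdu_comm (hf : ContDiffAt ℝ 2 f p) : pdx (pdu f) p = pdu (pdx f) p := by
  have := fderiv_fderiv_comm hf (0, 1, 0) (0, 0, 1)
  rwa [fderiv_fderiv_apply hf, fderiv_fderiv_apply hf] at this

theorem pdt_pdx_comm (hf : ContDiffAt ℝ 2 f p) : pdt (pdx f) p = pdx (pdt f) p := by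
  have := fderiv_fderiv_comm hf (1, 0, 0) (0, 1, 0)
  rwa [fderiv_fderiv_apply hf, fderiv_fderiv_apply hf] at this

theorem fderiv_fderiv_tt (hf : ContDiffAt ℝ 2 f p) (q : ℝ) :
    fderiv ℝ (fderiv ℝ f) p (1, 0, q) (1, 0, q) =
      pdt (pdt f) p + 2 * q * pdt (pdu f) p + q ^ 2 * pdu (pdu f) p := by
  have e : ((1, 0, q) : J0) = (1, 0, 0) + q • (0, 0, 1) := by simp
  rw [e]
  simp only [map_add, map_smul, add_apply, smul_apply, smul_eq_mul, fderiv_fderiv_apply hf]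
  change pdt (pdt f) p + q * pdu (pdt f) p + q * (pdt (pdu f) p + q * pdu (pdu f) p) = _
  rw [← pdt_pdu_comm hf]
  ring

theorem fderiv_fderiv_xx (hf : ContDiffAt ℝ 2 f p) (q : ℝ) :
    fderiv ℝ (fderiv ℝ f) p (0, 1, q) (0, 1, q) =
      pdx (pdx f) p + 2 * q * pdx (pdu f) p + q ^ 2 * pdu (pdu f) p := by
  have e : ((0, 1, q) : J0) = (0, 1, 0) + q • (0, 0, 1) := by simp
  rw [e]
  simp only [map_add, map_smul, add_apply, smul_apply, smul_eq_mul, fderiv_fderiv_apply hf]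
  change pdx (pdx f) p + q * pdu (pdx f) p + q * (pdx (pdu f) p + q * pdu (pdu f) p) = _
  rw [← pdx_pdu_comm hf]
  ring

theorem contDiffOn_fderiv_apply (hD : IsOpen D) (hf : ContDiffOn ℝ ∞ f D) (v : J0) :
    ContDiffOn ℝ ∞ (fun p => fderiv ℝ f p v) D :=
  (hf.fderiv_of_isOpen hD (by simp)).clm_apply contDiffOn_const

theorem contDiffAt_two (hD : IsOpen D) {E : Type*} [NormedAddCommGroup E] [NormedSpace ℝ E]
    {f : J0 → E} (hf : ContDiffOn ℝ ∞ f D) (hp : p ∈ D) :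
    ContDiffAt ℝ 2 f p :=
  (hf.contDiffAt (hD.mem_nhds hp)).of_le (WithTop.coe_le_coe.2 (le_top : (2 : ℕ∞) ≤ ⊤))

theorem fderiv_congr_on (hD : IsOpen D) (h : ∀ p ∈ D, f p = g p) (hp : p ∈ D) :
    fderiv ℝ f p = fderiv ℝ g p :=
  (Filter.eventuallyEq_of_mem (hD.mem_nhds hp) h).fderiv_eq

theorem exists_const_of_pd_eq_zero (hD : IsOpen D) (hc : IsPreconnected D)
    (hf : ContDiffOn ℝ ∞ f D) (ht : ∀ p ∈ D, pdt f p = 0) (hx : ∀ p ∈ D, pdx f p = 0)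
    (hu : ∀ p ∈ D, pdu f p = 0) : ∃ a, ∀ p ∈ D, f p = a := by
  refine hD.exists_is_const_of_fderiv_eq_zero (𝕜 := ℝ) hc (hf.differentiableOn (by simp)) ?_
  intro p hp
  rw [fderiv_eq_pd, ht p hp, hx p hp, hu p hp]
  simp

/-! ### The determining equations -/

theorem prolongApply_F_eq_pd {γ : ℝ} (ε : ℝ) {V : J0 → J0} {τ ξ η : J0 → ℝ}
    (hV : V = fun p => (τ p, ξ p, η p)) {P : J0} (hP : P ∈ posRegion γ)
    (hτ : ContDiffAt ℝ 2 τ P) (hξ : ContDiffAt ℝ 2 ξ P) (hη : ContDiffAt ℝ 2 η P)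
    (p q m s r : ℝ) :
    prolongApply V (F γ ε) ((P, (p, q)), (m, s, r)) =
      (pdt (pdt η) P + 2 * p * pdt (pdu η) P + p ^ 2 * pdu (pdu η) P
        - p * (pdt (pdt τ) P + 2 * p * pdt (pdu τ) P + p ^ 2 * pdu (pdu τ) P)
        - q * (pdt (pdt ξ) P + 2 * p * pdt (pdu ξ) P + p ^ 2 * pdu (pdu ξ) P)
        + m * (pdu η P - p * pdu τ P - q * pdu ξ P)
        - 2 * m * (pdt τ P + p * pdu τ P) - 2 * s * (pdt ξ P + p * pdu ξ P))
      - (K1 γ P.2.2 * (pdx (pdx η) P + 2 * q * pdx (pdu η) P + q ^ 2 * pdu (pdu η) P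
          - p * (pdx (pdx τ) P + 2 * q * pdx (pdu τ) P + q ^ 2 * pdu (pdu τ) P)
          - q * (pdx (pdx ξ) P + 2 * q * pdx (pdu ξ) P + q ^ 2 * pdu (pdu ξ) P)
          + r * (pdu η P - p * pdu τ P - q * pdu ξ P)
          - 2 * s * (pdx τ P + q * pdu τ P) - 2 * r * (pdx ξ P + q * pdu ξ P))
        + K2 γ P.2.2 * η P * r
        + 2 * K2 γ P.2.2 * q * (pdx η P + q * pdu η P - p * (pdx τ P + q * pdu τ P)
          - q * (pdx ξ P + q * pdu ξ P))
        + K3 γ P.2.2 * η P * q ^ 2)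
      + ε * (pdt η P + p * pdu η P - p * (pdt τ P + p * pdu τ P)
          - q * (pdt ξ P + p * pdu ξ P)) := by
  subst hV
  rw [prolongApply_F_eq (j := ((P, (p, q)), (m, s, r))) ε _ hP,
    etaTT_eq (j := ((P, (p, q)), (m, s, r))) hτ hξ hη,
    etaXX_eq (j := ((P, (p, q)), (m, s, r))) hτ hξ hη]
  simp only [etaT, etaX, Dt0, Dx0, fderiv_fderiv_tt hτ, fderiv_fderiv_tt hξ, fderiv_fderiv_tt hη,
    fderiv_fderiv_xx hτ, fderiv_fderiv_xx hξ, fderiv_fderiv_xx hη, fderiv_apply_eq]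
  ring

/-- The coefficients of `u_tx`, `u_t u_tx`, `u_x u_tx`, `u_xx`, `u_t` and `u_x` in the
determining equation. -/
theorem determining_equations {γ : ℝ} {V : J0 → J0} {τ ξ η : J0 → ℝ}
    (hV : V = fun p => (τ p, ξ p, η p)) {P : J0} (hP : P ∈ posRegion γ)
    (h0 : γ ≠ 0) (h1 : γ ≠ 1) (hPD : P ∈ D) (hsym : IsSymmetry γ 0 D V)
    (hτ : ContDiffAt ℝ 2 τ P) (hξ : ContDiffAt ℝ 2 ξ P) (hη : ContDiffAt ℝ 2 η P) :
    pdt ξ P = K1 γ P.2.2 * pdx τ P ∧ pdu ξ P = 0 ∧ pdu τ P = 0 ∧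
    K2 γ P.2.2 * η P = 2 * K1 γ P.2.2 * (pdx ξ P - pdt τ P) ∧
    2 * pdt (pdu η) P - pdt (pdt τ) P + K1 γ P.2.2 * pdx (pdx τ) P = 0 ∧
    pdt (pdt ξ) P + K1 γ P.2.2 * (2 * pdx (pdu η) P - pdx (pdx ξ) P)
      + 2 * K2 γ P.2.2 * pdx η P = 0 := by
  -- Solving the equation for u_tt leaves p = u_t, q = u_x, s = u_tx, r = u_xx free, so the symmetry
  -- condition is a polynomial identity in them.
  have key : ∀ p q s r : ℝ, _ = (0 : ℝ) := fun p q s r =>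
    (prolongApply_F_eq_pd 0 hV hP hτ hξ hη p q
      (K1 γ P.2.2 * r + K2 γ P.2.2 * q ^ 2) s r).symm.trans
      (hsym ((P, (p, q)), (K1 γ P.2.2 * r + K2 γ P.2.2 * q ^ 2, s, r)) hPD
        (by rw [F_eq 0 hP]; ring))
  have hK := K1_ne_zero h0 h1 hP
  -- Coefficients are read off from finitely many values. Differences between s = 1 and s = -1
  -- isolate the u_tx terms. The combination (8(f(1) - f(-1)) - (f(2) - f(-2)))/12 extracts the
  -- linear coefficient of a cubic f, and is used for u_t and u_x.
  have a1 := key 0 0 1 0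
  have a2 := key 0 0 (-1) 0
  have a3 := key 1 0 1 0
  have a4 := key 1 0 (-1) 0
  have a5 := key 0 1 1 0
  have a6 := key 0 1 (-1) 0
  have a7 := key 0 0 0 1
  have a8 := key 0 0 0 0
  have b1 := key 1 0 0 0
  have b2 := key (-1) 0 0 0
  have b3 := key 2 0 0 0
  have b4 := key (-2) 0 0 0
  have d1 := key 0 1 0 0
  have d2 := key 0 (-1) 0 0
  have d3 := key 0 2 0 0
  have d4 := key 0 (-2) 0 0
  clear key
  refine ⟨?_, ?_, ?_, ?_, ?_, ?_⟩
  · linear_combination (-1 / 4) * (a1 - a2)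
  · linear_combination (-1 / 4) * (a3 - a4) + (1 / 4) * (a1 - a2)
  · refine (mul_eq_zero.1 ?_).resolve_left hK
    linear_combination (1 / 4) * (a5 - a6) - (1 / 4) * (a1 - a2)
  · linear_combination a8 - a7
  · linear_combination (1 / 12) * (8 * (b1 - b2) - (b3 - b4))
  · linear_combination (-1 / 12) * (8 * (d1 - d2) - (d3 - d4))

end

section

/-! ### Classification of the exact and the approximate generators -/

variable {γ : ℝ} {D : Set J0}

theorem fderiv_eq_zero_on {f : J0 → ℝ} {p : J0} (hD : IsOpen D) (h : ∀ p ∈ D, f p = 0)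
    (hp : p ∈ D) : fderiv ℝ f p = 0 := by
  rw [fderiv_congr_on (g := fun _ => 0) hD h hp]
  simp

theorem pdt_eq_zero_on {f : J0 → ℝ} {p : J0} (hD : IsOpen D) (h : ∀ p ∈ D, f p = 0)
    (hp : p ∈ D) : pdt f p = 0 := by
  rw [pdt, fderiv_eq_zero_on hD h hp, zero_apply]

theorem pdx_eq_zero_on {f : J0 → ℝ} {p : J0} (hD : IsOpen D) (h : ∀ p ∈ D, f p = 0)
    (hp : p ∈ D) : pdx f p = 0 := by
  rw [pdx, fderiv_eq_zero_on hD h hp, zero_apply]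

/-- Subtracting the affine candidate leaves a function with zero derivative, constant because D is
open and preconnected. -/
theorem exists_affine_of_pd {f : J0 → ℝ} (hD : IsOpen D) (hc : IsPreconnected D)
    (hf : ContDiffOn ℝ ∞ f D) {a b : ℝ} (ht : ∀ p ∈ D, pdt f p = a)
    (hx : ∀ p ∈ D, pdx f p = b) (hu : ∀ p ∈ D, pdu f p = 0) :
    ∃ e, ∀ p ∈ D, f p = a * p.1 + b * p.2.1 + e := by
  have hd : ∀ p ∈ D, HasFDerivAt (fun p : J0 => f p - (a * p.1 + b * p.2.1))
      (fderiv ℝ f p - (a • coordT + b • coordX)) p := fun p hp =>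
    ((contDiffAt_two hD hf hp).differentiableAt (by norm_num)).hasFDerivAt.sub
      (((hasFDerivAt_t p).const_mul a).add ((hasFDerivAt_x p).const_mul b))
  obtain ⟨e, he⟩ := hD.exists_is_const_of_fderiv_eq_zero (𝕜 := ℝ) hc
    (f := fun p : J0 => f p - (a * p.1 + b * p.2.1))
    (fun p hp => (hd p hp).differentiableAt.differentiableWithinAt) (fun p hp => by
      rw [(hd p hp).fderiv, fderiv_eq_pd, ht p hp, hx p hp, hu p hp]
      simp)
  exact ⟨e, fun p hp => by linear_combination he p hp⟩

theorem exists_eq_polyField_of_isSymmetry (h0 : γ ≠ 0) (h1 : γ ≠ 1) (h2 : γ ≠ 2)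
    (h2' : γ ≠ -2) (h3 : γ ≠ 2 / 3) (hDo : IsOpen D) (hDc : IsPreconnected D)
    (hD : D ⊆ posRegion γ) {V : J0 → J0} (hV : ContDiffOn ℝ ∞ V D)
    (hsym : IsSymmetry γ 0 D V) :
    ∃ c : Fin 4 → ℝ, ∀ p ∈ D, V p =
      polyField γ 0 (c 0) (c 1) (c 0 + c 3) (c 2) (2 * γ / (γ - 2) * c 3) 0 p := by
  have hm : γ - 2 ≠ 0 := sub_ne_zero.2 h2
  have hp2 : γ + 2 ≠ 0 := fun h => h2' (by linarith)
  have hp3 : 3 * γ - 2 ≠ 0 := fun h => h3 (by linarith)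
  obtain ⟨τ, hτdef⟩ : ∃ τ : J0 → ℝ, τ = fun p => (V p).1 := ⟨_, rfl⟩
  obtain ⟨ξ, hξdef⟩ : ∃ ξ : J0 → ℝ, ξ = fun p => (V p).2.1 := ⟨_, rfl⟩
  obtain ⟨η, hηdef⟩ : ∃ η : J0 → ℝ, η = fun p => (V p).2.2 := ⟨_, rfl⟩
  have hVe : V = fun p => (τ p, ξ p, η p) := by subst hτdef hξdef hηdef; rfl
  have hτ : ContDiffOn ℝ ∞ τ D := hτdef ▸ hV.fst
  have hξ : ContDiffOn ℝ ∞ ξ D := hξdef ▸ hV.snd.fst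
  have hη : ContDiffOn ℝ ∞ η D := hηdef ▸ hV.snd.snd
  have hτ2 : ∀ p ∈ D, ContDiffAt ℝ 2 τ p := fun p hp => contDiffAt_two hDo hτ hp
  have hξ2 : ∀ p ∈ D, ContDiffAt ℝ 2 ξ p := fun p hp => contDiffAt_two hDo hξ hp
  have hη2 : ∀ p ∈ D, ContDiffAt ℝ 2 η p := fun p hp => contDiffAt_two hDo hη hp
  have det := fun P (hP : P ∈ D) => determining_equations hVe (hD hP) h0 h1 hP hsym
    (hτ2 P hP) (hξ2 P hP) (hη2 P hP)
  have hK1 := fun P (hP : P ∈ D) => K1_ne_zero h0 h1 (hD hP)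
  have hK2 := fun P (hP : P ∈ D) => K2_ne_zero h0 h1 h2 (hD hP)
  have hξu : ∀ P ∈ D, pdu ξ P = 0 := fun P hP => (det P hP).2.1
  have hτu : ∀ P ∈ D, pdu τ P = 0 := fun P hP => (det P hP).2.2.1
  have diff : ∀ {f : J0 → ℝ}, ContDiffOn ℝ ∞ f D → ∀ P ∈ D, HasFDerivAt f (fderiv ℝ f P) P :=
    fun hf P hP => ((contDiffAt_two hDo hf hP).differentiableAt (by norm_num)).hasFDerivAt
  have hτt' : ContDiffOn ℝ ∞ (pdt τ) D := contDiffOn_fderiv_apply hDo hτ _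
  have hτx' : ContDiffOn ℝ ∞ (pdx τ) D := contDiffOn_fderiv_apply hDo hτ _
  have hξx' : ContDiffOn ℝ ∞ (pdx ξ) D := contDiffOn_fderiv_apply hDo hξ _
  have hτx : ∀ P ∈ D, pdx τ P = 0 := by
    intro P hP
    have hd : HasFDerivAt (fun p : J0 => K1 γ p.2.2 * pdx τ p) _ P :=
      (hasFDerivAt_comp_u (hasDerivAt_K1 (γ := γ) (hD hP))).mul (diff hτx' P hP)
    -- Differentiate ξ_t = K1 τ_x in u. As ξ and τ do not depend on u, only K2 τ_x = 0 survives, and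
    -- K2 ≠ 0.
    have e1 : pdu (pdt ξ) P = K2 γ P.2.2 * pdx τ P + K1 γ P.2.2 * pdu (pdx τ) P := by
      rw [pdu, fderiv_congr_on hDo (fun p hp => (det p hp).1) hP, hd.fderiv, pdu]
      simp
      ring
    rw [← pdt_pdu_comm (hξ2 P hP), ← pdx_pdu_comm (hτ2 P hP), pdt_eq_zero_on hDo hξu hP,
      pdx_eq_zero_on hDo hτu hP] at e1
    simpa [hK2 P hP] using e1
  have hξt : ∀ P ∈ D, pdt ξ P = 0 := fun P hP => by
    rw [(det P hP).1, hτx P hP, mul_zero]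
  have hηe : ∀ P ∈ D, η P = 2 * γ / (γ - 2) * ((1 + P.2.2 / γ) * (pdx ξ P - pdt τ P)) := by
    intro P hP
    have e := (det P hP).2.2.2.1
    have e2 := K2_mul_base (γ := γ) (hD hP)
    refine mul_left_cancel₀ (hK2 P hP) ?_
    calc K2 γ P.2.2 * η P = 2 * γ / (γ - 2) * ((γ - 2) / γ * K1 γ P.2.2) * (pdx ξ P - pdt τ P) := by
          rw [e]; field_simp
      _ = _ := by rw [← e2]; ring
  have hdf : ∀ P ∈ D, fderiv ℝ (fun p => pdx ξ p - pdt τ p) P =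
      fderiv ℝ (pdx ξ) P - fderiv ℝ (pdt τ) P := fun P hP =>
    ((diff hξx' P hP).sub (diff hτt' P hP)).fderiv
  have hdt : ∀ P ∈ D, pdt (fun p => pdx ξ p - pdt τ p) P = -pdt (pdt τ) P := by
    intro P hP
    rw [pdt, hdf P hP]
    change pdt (pdx ξ) P - pdt (pdt τ) P = _
    rw [pdt_pdx_comm (hξ2 P hP), pdx_eq_zero_on hDo hξt hP, zero_sub]
  have hdx : ∀ P ∈ D, pdx (fun p => pdx ξ p - pdt τ p) P = pdx (pdx ξ) P := by
    intro P hP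
    rw [pdx, hdf P hP]
    change pdx (pdx ξ) P - pdx (pdt τ) P = _
    rw [← pdt_pdx_comm (hτ2 P hP), pdt_eq_zero_on hDo hτx hP, sub_zero]
  have hdu : ∀ P ∈ D, pdu (fun p => pdx ξ p - pdt τ p) P = 0 := by
    intro P hP
    rw [pdu, hdf P hP]
    change pdu (pdx ξ) P - pdu (pdt τ) P = _
    rw [← pdx_pdu_comm (hξ2 P hP), ← pdt_pdu_comm (hτ2 P hP), pdx_eq_zero_on hDo hξu hP,
      pdt_eq_zero_on hDo hτu hP, sub_zero]
  -- Here d = ξ_x - τ_t satisfies d_t = -τ_tt, d_x = ξ_xx, d_u = 0, and η is a constant times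
  -- (1+u/γ) d.
  obtain ⟨d, hd⟩ : ∃ d : J0 → ℝ, d = fun p => pdx ξ p - pdt τ p := ⟨_, rfl⟩
  have hdc : ContDiffOn ℝ ∞ d D := hd ▸ hξx'.sub hτt'
  have hηf : ∀ P ∈ D, fderiv ℝ η P = (2 * γ / (γ - 2)) •
      ((1 + P.2.2 / γ) • fderiv ℝ d P + d P • γ⁻¹ • coordU) := by
    intro P hP
    rw [fderiv_congr_on hDo hηe hP, ← (((hasFDerivAt_base γ P).mul
      (diff hdc P hP)).const_mul (2 * γ / (γ - 2))).fderiv]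
    subst hd
    rfl
  rw [← hd] at hdt hdx hdu
  have hηx : ∀ P ∈ D, pdx η P = 2 * γ / (γ - 2) * (1 + P.2.2 / γ) * pdx (pdx ξ) P := by
    intro P hP
    rw [pdx, hηf P hP, ← hdx P hP, pdx]
    simp
    ring
  have hηu : ∀ P ∈ D, pdu η P = 2 / (γ - 2) * d P := by
    intro P hP
    have := hdu P hP
    rw [pdu] at this
    rw [pdu, hηf P hP]
    simp [this]
    field_simp
  have hηuf : ∀ P ∈ D, fderiv ℝ (pdu η) P = (2 / (γ - 2)) • fderiv ℝ d P := by
    intro P hP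
    rw [fderiv_congr_on hDo hηu hP]
    exact ((diff hdc P hP).const_mul _).fderiv
  -- The u_t coefficient, with η_tu = -2 τ_tt/(γ-2), becomes a nonzero multiple of (γ+2) τ_tt.
  have hτtt : ∀ P ∈ D, pdt (pdt τ) P = 0 := by
    intro P hP
    have e := (det P hP).2.2.2.2.1
    have e' : pdt (pdu η) P = 2 / (γ - 2) * -pdt (pdt τ) P := by
      rw [pdt, hηuf P hP, ← hdt P hP, pdt]; simp
    rw [e', pdx_eq_zero_on hDo hτx hP] at e
    refine (mul_eq_zero.1 (?_ : (γ + 2) * pdt (pdt τ) P = 0)).resolve_left hp2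
    have : (γ + 2) * pdt (pdt τ) P = -(γ - 2) * (2 * (2 / (γ - 2) * -pdt (pdt τ) P)
        - pdt (pdt τ) P + K1 γ P.2.2 * 0) := by
      field_simp
      ring
    rw [this, e, mul_zero]
  -- The u_x coefficient becomes a multiple of (3γ-2) K1 ξ_xx; this is where γ = 2/3 is exceptional.
  have hξxx : ∀ P ∈ D, pdx (pdx ξ) P = 0 := by
    intro P hP
    have e := (det P hP).2.2.2.2.2
    have e' : pdx (pdu η) P = 2 / (γ - 2) * pdx (pdx ξ) P := by
      rw [pdx, hηuf P hP, ← hdx P hP, pdx]; simp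
    have e2 := K2_mul_base (γ := γ) (hD hP)
    rw [e', pdt_eq_zero_on hDo hξt hP, hηx P hP,
      show 2 * K2 γ P.2.2 * (2 * γ / (γ - 2) * (1 + P.2.2 / γ) * pdx (pdx ξ) P) =
        4 * γ / (γ - 2) * (K2 γ P.2.2 * (1 + P.2.2 / γ)) * pdx (pdx ξ) P by ring, e2] at e
    have : (3 * γ - 2) * K1 γ P.2.2 * pdx (pdx ξ) P = 0 := by
      rw [zero_add] at e
      field_simp at e
      linear_combination e
    exact (mul_eq_zero.1 this).resolve_left (mul_ne_zero hp3 (hK1 P hP))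
  obtain ⟨a, ha⟩ := exists_const_of_pd_eq_zero hDo hDc hτt' hτtt
    (fun P hP => by rw [← pdt_pdx_comm (hτ2 P hP), pdt_eq_zero_on hDo hτx hP])
    (fun P hP => by rw [← pdt_pdu_comm (hτ2 P hP), pdt_eq_zero_on hDo hτu hP])
  obtain ⟨b, hb⟩ := exists_const_of_pd_eq_zero hDo hDc hξx'
    (fun P hP => by rw [pdt_pdx_comm (hξ2 P hP), pdx_eq_zero_on hDo hξt hP]) hξxx
    (fun P hP => by rw [← pdx_pdu_comm (hξ2 P hP), pdx_eq_zero_on hDo hξu hP])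
  obtain ⟨a', ha'⟩ := exists_affine_of_pd hDo hDc hτ ha hτx hτu
  obtain ⟨b', hb'⟩ := exists_affine_of_pd hDo hDc hξ hξt hb hξu
  -- The constants are a = τ_t and b = ξ_x, so c 3 = b - a is the coefficient of X₄.
  refine ⟨![a, a', b', b - a], fun p hp => ?_⟩
  have e := hηe p hp
  rw [ha p hp, hb p hp] at e
  rw [hVe]
  simp only [polyField, ha' p hp, hb' p hp, e, Prod.mk.injEq]
  refine ⟨?_, ?_, ?_⟩ <;> simp
  ring

/-- The shift of u_tt by -ε u_t compensates the damping term exactly, so F vanishes identically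
along the family. Every jet of the unperturbed equation thus starts an admissible family. -/
theorem F_isLittleO {P : J0} (hP : P ∈ posRegion γ) {p q m s r : ℝ}
    (hF : F γ 0 ((P, (p, q)), (m, s, r)) = 0) :
    (fun ε => F γ ε ((P, (p, q)), (m - ε * p, s, r))) =o[𝓝 0] fun ε : ℝ => ε := by
  refine (Asymptotics.isLittleO_zero _ _).congr_left fun ε => ?_
  rw [F_eq 0 hP] at hF
  rw [F_eq (j := ((P, (p, q)), (m - ε * p, s, r))) ε hP]
  simp only at hF ⊢
  linear_combination -hF

theorem IsApproxSymmetry.isSymmetry {V₀ V₁ : J0 → J0}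
    (h : IsApproxSymmetry γ D fun ε p => V₀ p + ε • V₁ p) (hD : D ⊆ posRegion γ) :
    IsSymmetry γ 0 D V₀ := by
  rintro ⟨⟨P, p, q⟩, m, s, r⟩ hP hF
  have h' := h (fun ε => ((P, (p, q)), (m - ε * p, s, r)))
    (by fun_prop) hP (F_isLittleO (hD hP) hF)
  -- The filter is the full neighbourhood of 0, so the estimate includes ε = 0 and forces the value
  -- there to vanish.
  have h0 := (Asymptotics.IsLittleO.eventuallyLE h').self_of_nhds
  simpa using h0

/-- A perturbation `ε V` of an approximate symmetry which again is an approximate symmetry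
comes from an exact symmetry `V` of the unperturbed equation. -/
theorem IsApproxSymmetry.isSymmetry_of_add {X : ℝ → J0 → J0} {V : J0 → J0}
    (hX : IsApproxSymmetry γ D X) (hXV : IsApproxSymmetry γ D fun ε p => X ε p + ε • V p)
    (hDo : IsOpen D) (hD : D ⊆ posRegion γ) (hXd : ∀ ε, ContDiffOn ℝ ∞ (X ε) D)
    (hV : ContDiffOn ℝ ∞ V D) : IsSymmetry γ 0 D V := by
  rintro ⟨⟨P, p, q⟩, m, s, r⟩ hP hF
  have hFe := F_isLittleO (hD hP) hF
  have e1 := hX (fun ε => ((P, (p, q)), (m - ε * p, s, r))) (by fun_prop) hP hFe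
  have e2 := hXV (fun ε => ((P, (p, q)), (m - ε * p, s, r))) (by fun_prop) hP hFe
  have hV2 := contDiffAt_two hDo hV hP
  have e3 : (fun ε => ε * prolongApply V (F γ ε) ((P, (p, q)), (m - ε * p, s, r)))
      =o[𝓝 0] fun ε : ℝ => ε := by
    refine (e2.sub e1).congr_left fun ε => ?_
    rw [prolongApply_F_add_smul ε ε (j := ((P, (p, q)), (m - ε * p, s, r))) (hD hP)
      (contDiffAt_two hDo (hXd ε) hP) hV2]
    ring
  have hc : ContinuousAt
      (fun ε => prolongApply V (F γ ε) ((P, (p, q)), (m - ε * p, s, r))) 0 := by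
    refine ContinuousAt.congr ?_ (Filter.Eventually.of_forall fun ε =>
      (prolongApply_F_eq_pd ε (V := V) rfl (hD hP) hV2.fst hV2.snd.fst hV2.snd.snd p q
        (m - ε * p) s r).symm)
    fun_prop
  -- Dividing by ε is legitimate on the punctured neighbourhood; continuity in ε then identifies the
  -- limit with the value at ε = 0.
  have e4 := (e3.tendsto_div_nhds_zero.mono_left
    (nhdsWithin_le_nhds (s := {(0 : ℝ)}ᶜ))).congr' (f₂ := fun ε =>
      prolongApply V (F γ ε) ((P, (p, q)), (m - ε * p, s, r))) (by
    filter_upwards [self_mem_nhdsWithin] with ε hε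
    exact mul_div_cancel_left₀ _ hε)
  have e5 := tendsto_nhds_unique (hc.tendsto.mono_left nhdsWithin_le_nhds) e4
  simpa using e5

theorem isSymmetry_iff (h0 : γ ≠ 0) (h1 : γ ≠ 1) (h2 : γ ≠ 2) (h2' : γ ≠ -2)
    (h3 : γ ≠ 2 / 3) (hDo : IsOpen D) (hDc : IsPreconnected D) (hD : D ⊆ posRegion γ)
    {V : J0 → J0} (hV : ContDiffOn ℝ ∞ V D) :
    IsSymmetry γ 0 D V ↔ ∃ c : Fin 4 → ℝ, ∀ p ∈ D, V p =
      (c 0 • X10 + c 1 • X2 + c 2 • X3 + c 3 • X4 γ : SmoothVF).1 p := by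
  constructor
  · intro h
    obtain ⟨c, hc⟩ := exists_eq_polyField_of_isSymmetry h0 h1 h2 h2' h3 hDo hDc hD hV h
    exact ⟨c, fun p hp => by rw [exactX_eq_polyField, hc p hp]⟩
  · rintro ⟨c, hc⟩
    exact (isSymmetry_exactX h0 h2 hD c).congr hDo fun p hp => (hc p hp).symm

theorem isApproxSymmetry_iff (h0 : γ ≠ 0) (h1 : γ ≠ 1) (h2 : γ ≠ 2) (h2' : γ ≠ -2)
    (h3 : γ ≠ 2 / 3) (hDo : IsOpen D) (hDc : IsPreconnected D) (hD : D ⊆ posRegion γ)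
    {V₀ V₁ : J0 → J0} (hV₀ : ContDiffOn ℝ ∞ V₀ D) (hV₁ : ContDiffOn ℝ ∞ V₁ D) :
    IsApproxSymmetry γ D (fun ε p => V₀ p + ε • V₁ p) ↔
      ∃ c k : Fin 4 → ℝ, ∀ ε : ℝ, ∀ p ∈ D, V₀ p + ε • V₁ p = generalX γ c k ε p := by
  constructor
  · intro h
    obtain ⟨a, ha⟩ := exists_eq_polyField_of_isSymmetry h0 h1 h2 h2' h3 hDo hDc hD hV₀
      (h.isSymmetry hD)
    -- The last two entries are swapped: the exact fields list X₃ before X₄, while `generalX` has X₄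
    -- at index 2 and X₃ at index 3.
    set c : Fin 4 → ℝ := ![a 0, a 1, a 3, a 2] with hc
    have hG := isApproxSymmetry_generalX h0 h2 h2' hDo hD c 0
    -- With k = 0 this field is affine in ε, so its order-ε part is the difference of its values at
    -- 1 and 0. It completes V₀ to an approximate symmetry.
    have hG0 : ∀ ε, ∀ p ∈ D, generalX γ c 0 ε p =
        V₀ p + ε • (generalX γ c 0 1 p - generalX γ c 0 0 p) := by
      intro ε p hp
      rw [ha p hp]
      simp only [hc, generalX, polyField, Prod.mk_sub_mk, Prod.smul_mk, Prod.mk_add_mk,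
        smul_eq_mul, Prod.mk.injEq]
      refine ⟨?_, ?_, ?_⟩ <;> simp <;> ring
    have hGd : ∀ ε, ContDiffOn ℝ ∞ (generalX γ c 0 ε) D := fun ε => by
      rw [generalX_eq_polyField]; exact (contDiff_polyField ..).contDiffOn
    have hW : ContDiffOn ℝ ∞ (fun p => V₁ p - (generalX γ c 0 1 p - generalX γ c 0 0 p)) D :=
      hV₁.sub ((hGd 1).sub (hGd 0))
    have hs : IsSymmetry γ 0 D (fun p => V₁ p - (generalX γ c 0 1 p - generalX γ c 0 0 p)) := by
      refine hG.isSymmetry_of_add (h.congr hDo fun ε p hp => ?_) hDo hD hGd hW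
      rw [hG0 ε p hp]
      module
    obtain ⟨b, hb⟩ := exists_eq_polyField_of_isSymmetry h0 h1 h2 h2' h3 hDo hDc hD hW hs
    refine ⟨c, ![b 0, b 1, b 3, b 2], fun ε p hp => ?_⟩
    have e : V₀ p + ε • V₁ p = generalX γ c 0 ε p
        + ε • (V₁ p - (generalX γ c 0 1 p - generalX γ c 0 0 p)) := by
      rw [hG0 ε p hp]; module
    rw [e, hb p hp]
    simp only [generalX, polyField, Prod.smul_mk, Prod.mk_add_mk, smul_eq_mul, Prod.mk.injEq]
    refine ⟨?_, ?_, ?_⟩ <;> simp <;> ring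
  · rintro ⟨c, k, h⟩
    exact (isApproxSymmetry_generalX h0 h2 h2' hDo hD c k).congr hDo
      fun ε p hp => (h ε p hp).symm

end

/-! ### Abstract consequences of the commutation relations -/

section Abstract

attribute [local instance] LieRing.ofAssociativeRing

variable {L : Type*} [LieRing L] [LieAlgebra ℝ L]

theorem spansSubalgebra_of_lie_mem {S : Set L}
    (h : ∀ a ∈ S, ∀ b ∈ S, ⁅a, b⁆ ∈ Submodule.span ℝ S) : SpansSubalgebra S := by
  refine ⟨{ Submodule.span ℝ S with lie_mem' := fun {a b} ha hb => ?_ }, rfl⟩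
  refine Submodule.span_induction₂ (p := fun a b _ _ => ⁅a, b⁆ ∈ Submodule.span ℝ S)
    (fun a b ha hb => h a ha b hb) ?_ ?_ ?_ ?_ ?_ ?_ ha hb
  · intro b _; rw [zero_lie]; exact zero_mem _
  · intro a _; rw [lie_zero]; exact zero_mem _
  · intro a b c _ _ _ h1 h2; rw [add_lie]; exact add_mem h1 h2
  · intro a b c _ _ _ h1 h2; rw [lie_add]; exact add_mem h1 h2
  · intro r a b _ _ h1; rw [smul_lie]; exact Submodule.smul_mem _ _ h1
  · intro r a b _ _ h1; rw [lie_smul]; exact Submodule.smul_mem _ _ h1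

variable {γ ε : ℝ} {x₁ x₂ x₃ x₄ z y : L}

theorem CommRel.spansSubalgebra_four (h : CommRel γ 0 x₁ x₂ x₃ x₄ z y) :
    SpansSubalgebra {x₁, x₂, x₃, x₄} := by
  have m2 : x₂ ∈ Submodule.span ℝ {x₁, x₂, x₃, x₄} := Submodule.subset_span (by simp)
  have m3 : x₃ ∈ Submodule.span ℝ {x₁, x₂, x₃, x₄} := Submodule.subset_span (by simp)
  have r12 := lie_skew x₁ x₂
  have r31 := lie_skew x₃ x₁
  have r41 := lie_skew x₄ x₁
  have r32 := lie_skew x₃ x₂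
  have r42 := lie_skew x₄ x₂
  have r43 := lie_skew x₄ x₃
  rw [h.x2_x1] at r12
  rw [h.x1_x3] at r31
  rw [h.x1_x4] at r41
  rw [h.x2_x3] at r32
  rw [h.x2_x4] at r42
  rw [h.x3_x4] at r43
  refine spansSubalgebra_of_lie_mem ?_
  rintro a (rfl | rfl | rfl | rfl) b (rfl | rfl | rfl | rfl) <;>
    simp only [lie_self, h.x2_x1, h.x2_x4, h.x2_x3, h.x1_x4, h.x1_x3, h.x3_x4, ← r12, ← r31,
      ← r41, ← r32, ← r42, ← r43, zero_smul, add_zero, neg_zero, neg_neg, neg_mem_iff,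
      zero_mem, m2, m3]

theorem CommRel.spansSubalgebra (h : CommRel γ ε x₁ x₂ x₃ x₄ z y) :
    SpansSubalgebra {x₁, x₂, x₃, x₄, z, y} := by
  have m2 : x₂ ∈ Submodule.span ℝ {x₁, x₂, x₃, x₄, z, y} := Submodule.subset_span (by simp)
  have m3 : x₃ ∈ Submodule.span ℝ {x₁, x₂, x₃, x₄, z, y} := Submodule.subset_span (by simp)
  have mz : z ∈ Submodule.span ℝ {x₁, x₂, x₃, x₄, z, y} := Submodule.subset_span (by simp)
  have my : y ∈ Submodule.span ℝ {x₁, x₂, x₃, x₄, z, y} := Submodule.subset_span (by simp)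
  have m21 := add_mem m2 (Submodule.smul_mem _ ε mz)
  have r12 := lie_skew x₁ x₂
  have r31 := lie_skew x₃ x₁
  have r41 := lie_skew x₄ x₁
  have r32 := lie_skew x₃ x₂
  have r42 := lie_skew x₄ x₂
  have r43 := lie_skew x₄ x₃
  have rz1 := lie_skew z x₁
  have rz2 := lie_skew z x₂
  have rz3 := lie_skew z x₃
  have rz4 := lie_skew z x₄
  have ry1 := lie_skew y x₁
  have ry2 := lie_skew y x₂
  have ry3 := lie_skew y x₃
  have ry4 := lie_skew y x₄
  have ryz := lie_skew y z
  rw [h.x2_x1] at r12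
  rw [h.x1_x3] at r31
  rw [h.x1_x4] at r41
  rw [h.x2_x3] at r32
  rw [h.x2_x4] at r42
  rw [h.x3_x4] at r43
  rw [h.x1_z] at rz1
  rw [h.x2_z] at rz2
  rw [h.x3_z] at rz3
  rw [h.x4_z] at rz4
  rw [h.x1_y] at ry1
  rw [h.x2_y] at ry2
  rw [h.x3_y] at ry3
  rw [h.x4_y] at ry4
  rw [h.z_y] at ryz
  refine spansSubalgebra_of_lie_mem ?_
  rintro a (rfl | rfl | rfl | rfl | rfl | rfl) b (rfl | rfl | rfl | rfl | rfl | rfl) <;>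
    simp only [lie_self, h.x2_x1, h.x2_x4, h.x2_x3, h.x1_x4, h.x1_x3, h.x3_x4, h.x1_z, h.x1_y,
      h.x2_y, h.x2_z, h.z_y, h.x3_y, h.x3_z, h.x4_y, h.x4_z, ← r12, ← r31, ← r41, ← r32, ← r42,
      ← r43, ← rz1, ← rz2, ← rz3, ← rz4, ← ry1, ← ry2, ← ry3, ← ry4, ← ryz, neg_mem_iff,
      zero_mem, m2, m3, mz, my, m21, Submodule.smul_mem]

/-! ### Identification with sl(2, ℝ) -/

theorem sl2_apply_one_one (M : LieAlgebra.SpecialLinear.sl (Fin 2) ℝ) :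
    M.1 1 1 = -M.1 0 0 := by
  have h : M.1.trace = 0 := M.2
  rw [Matrix.trace_fin_two] at h
  linarith

/-- The Lie algebra homomorphism from `sl(2, ℝ)` determined by an `sl(2)`-triple, up to the
normalization of its elements. -/
def sl2Hom {κ : ℝ} (hκ : κ ≠ 0) (hxy : ⁅x₂, y⁆ = z) (hxz : ⁅x₂, z⁆ = κ • x₂)
    (hzy : ⁅z, y⁆ = κ • y) : LieAlgebra.SpecialLinear.sl (Fin 2) ℝ →ₗ⁅ℝ⁆ L where
  -- The standard basis maps by e ↦ y, h ↦ (2/κ) z, f ↦ -(2/κ) x₂, which rescales the structure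
  -- constant κ to 2.
  toFun M := (-(2 / κ) * M.1 1 0) • x₂ + (2 / κ * M.1 0 0) • z + M.1 0 1 • y
  map_add' M N := by
    have h : ∀ i j, (M + N).1 i j = M.1 i j + N.1 i j := fun _ _ => rfl
    simp only [h]
    module
  map_smul' r M := by
    have h : ∀ i j, (r • M).1 i j = r * M.1 i j := fun _ _ => rfl
    simp only [h, RingHom.id_apply]
    module
  map_lie' {M N} := by
    have hyx : ⁅y, x₂⁆ = -z := by rw [← lie_skew, hxy]
    have hzx : ⁅z, x₂⁆ = -(κ • x₂) := by rw [← lie_skew, hxz]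
    have hyz : ⁅y, z⁆ = -(κ • y) := by rw [← lie_skew, hzy]
    simp only [LieAlgebra.SpecialLinear.sl_bracket, Matrix.sub_apply, Matrix.mul_apply,
      Fin.sum_univ_two, sl2_apply_one_one, add_lie, lie_add, smul_lie, lie_smul, lie_self, hxy, hxz, hzy,
      hyx, hzx, hyz]
    match_scalars <;> field_simp <;> ring

theorem spansSl2 {κ : ℝ} (hκ : κ ≠ 0) (hxy : ⁅x₂, y⁆ = z) (hxz : ⁅x₂, z⁆ = κ • x₂)
    (hzy : ⁅z, y⁆ = κ • y)
    (hli : ∀ a b c : ℝ, a • x₂ + b • z + c • y = 0 → a = 0 ∧ b = 0 ∧ c = 0) :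
    SpansSl2 {x₂, z, y} := by
  have hinj : Function.Injective (sl2Hom hκ hxy hxz hzy) := by
    rw [injective_iff_map_eq_zero]
    intro M hM
    obtain ⟨h1, h2, h3⟩ := hli _ _ _ hM
    have hk : (2 : ℝ) / κ ≠ 0 := div_ne_zero two_ne_zero hκ
    have e10 : M.1 1 0 = 0 := (mul_eq_zero.1 h1).resolve_left (neg_ne_zero.2 hk)
    have e00 : M.1 0 0 = 0 := (mul_eq_zero.1 h2).resolve_left hk
    have e11 : M.1 1 1 = 0 := by rw [sl2_apply_one_one, e00, neg_zero]
    refine Subtype.ext (Matrix.ext fun i j => ?_)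
    fin_cases i <;> fin_cases j <;> simp [e10, e00, e11, h3]
  refine ⟨(sl2Hom hκ hxy hxz hzy).range, ?_, ⟨(LieEquiv.ofInjective _ hinj).symm⟩⟩
  ext v
  rw [LieSubalgebra.mem_toSubmodule, LieHom.mem_range, Submodule.mem_span_triple]
  constructor
  · rintro ⟨M, rfl⟩
    exact ⟨_, _, _, rfl⟩
  · rintro ⟨a, b, c, rfl⟩
    refine ⟨⟨!![κ / 2 * b, c; -(κ / 2) * a, -(κ / 2 * b)], ?_⟩, ?_⟩
    · change Matrix.trace !![κ / 2 * b, c; -(κ / 2) * a, -(κ / 2 * b)] = 0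
      simp [Matrix.trace_fin_two]
    · change (-(2 / κ) * (-(κ / 2) * a)) • x₂ + (2 / κ * (κ / 2 * b)) • z + c • y = _
      congr 3 <;> field_simp

theorem CommRel.spansSl2 (h : CommRel γ ε x₁ x₂ x₃ x₄ z y) (h2 : γ ≠ 2) (h2' : γ ≠ -2)
    (hli : ∀ a b c : ℝ, a • x₂ + b • z + c • y = 0 → a = 0 ∧ b = 0 ∧ c = 0) :
    SpansSl2 {x₂, z, y} :=
  BinomialWave.spansSl2 (div_ne_zero (sub_ne_zero.2 h2) fun h => h2' (by linarith))
    h.x2_y h.x2_z h.z_y hli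

/-- Linearly independent elements satisfying the commutation relations form a basis of an
abstract Lie algebra. -/
theorem CommRel.exists_basis {L : Type} [LieRing L] [LieAlgebra ℝ L] {v : Fin 6 → L}
    (h : CommRel γ ε (v 0) (v 1) (v 2) (v 3) (v 4) (v 5)) (h2 : γ ≠ 2) (h2' : γ ≠ -2)
    (hli : LinearIndependent ℝ v) :
    ∃ (A : LieSubalgebra ℝ L) (b : Module.Basis (Fin 6) ℝ A),
      CommRel γ ε (b 0) (b 1) (b 2) (b 3) (b 4) (b 5) ∧ SpansSl2 {b 1, b 4, b 5} ∧
      ∀ i, (b i : L) = v i := by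
  obtain ⟨A, hA⟩ := h.spansSubalgebra
  have hr : Set.range v = {v 0, v 1, v 2, v 3, v 4, v 5} := by
    ext w
    simp [Fin.exists_fin_succ, eq_comm]
  rw [← hr] at hA
  let b : Module.Basis (Fin 6) ℝ A :=
    (Module.Basis.span hli).map (LinearEquiv.ofEq _ _ hA.symm)
  have hb : ∀ i, (b i : L) = v i := fun i => by
    rw [Module.Basis.map_apply]
    exact congrArg Subtype.val (Module.Basis.span_apply hli i)
  have hrel : CommRel γ ε (b 0) (b 1) (b 2) (b 3) (b 4) (b 5) := by
    simp only [← hb] at h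
    constructor <;> apply Subtype.ext
    exacts [h.x2_x1, h.x2_x4, h.x2_x3, h.x1_x4, h.x1_x3, h.x3_x4, h.x1_z, h.x1_y, h.x2_y,
      h.x2_z, h.z_y, h.x3_y, h.x3_z, h.x4_y, h.x4_z]
  refine ⟨A, b, hrel, hrel.spansSl2 h2 h2' fun a b' c he => ?_, hb⟩
  have := Fintype.linearIndependent_iff.1 b.linearIndependent ![0, a, 0, 0, b', c]
    (by simpa [Fin.sum_univ_succ, add_assoc] using he)
  exact ⟨this 1, this 4, this 5⟩

end Abstract

section

/-! ### The commutation relations of the operators -/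

variable {γ : ℝ}

theorem fderiv_polyField_apply (γ a b c d e g h : ℝ) (p v : J0) :
    fderiv ℝ (polyField γ a b c d e g h) p v = ((a * p.1 + b) * v.1, d * v.2.1,
      h * (1 + p.2.2 / γ) * v.1 + (g + h * p.1) / γ * v.2.2) := by
  have hd := ((contDiff_polyField γ a b c d e g h (n := 1)).differentiable
    (by norm_num)).differentiableAt (x := p)
  have h1 : HasFDerivAt (polyField γ a b c d e g h) _ p :=
    hd.fst.hasFDerivAt.prodMk (hd.snd.fst.hasFDerivAt.prodMk hd.snd.snd.hasFDerivAt)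
  rw [h1.fderiv]
  simp only [polyField, fderiv_polyField_fst, fderiv_polyField_snd, fderiv_polyField_trd]
  simp

theorem lie_polyField {V W : SmoothVF} {a b c d e g h a' b' c' d' e' g' h' : ℝ}
    (hV : (V : J0 → J0) = polyField γ a b c d e g h)
    (hW : (W : J0 → J0) = polyField γ a' b' c' d' e' g' h') (p : J0) :
    (⁅V, W⁆ : SmoothVF).1 p =
      ((a' * p.1 + b') * (polyField γ a b c d e g h p).1
          - (a * p.1 + b) * (polyField γ a' b' c' d' e' g' h' p).1,
        d' * (polyField γ a b c d e g h p).2.1 - d * (polyField γ a' b' c' d' e' g' h' p).2.1,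
        h' * (1 + p.2.2 / γ) * (polyField γ a b c d e g h p).1
          + (g' + h' * p.1) / γ * (polyField γ a b c d e g h p).2.2
          - (h * (1 + p.2.2 / γ) * (polyField γ a' b' c' d' e' g' h' p).1
            + (g + h * p.1) / γ * (polyField γ a' b' c' d' e' g' h' p).2.2)) := by
  rw [coe_lie, VectorField.lieBracket, hV, hW, fderiv_polyField_apply, fderiv_polyField_apply]
  rfl

theorem coe_X1 (γ ε : ℝ) : (X1 γ ε : J0 → J0) =
    polyField γ (ε * ((γ - 2) / (γ + 2))) 1 0 1 0 0 (-(ε * (2 * γ / (γ + 2)))) := by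
  funext p
  simp only [X1, X10, Y, polyField, Submodule.coe_add, Submodule.coe_smul, Pi.add_apply,
    Pi.smul_apply, Prod.smul_mk, Prod.mk_add_mk, smul_eq_mul, Prod.mk.injEq]
  refine ⟨?_, ?_, ?_⟩ <;> ring

theorem coe_X2 (γ : ℝ) : (X2 : J0 → J0) = polyField γ 0 0 1 0 0 0 0 := by
  funext p; simp [X2, polyField]

theorem coe_X3 (γ : ℝ) : (X3 : J0 → J0) = polyField γ 0 0 0 0 1 0 0 := by
  funext p; simp [X3, polyField]

theorem coe_X4 (γ : ℝ) : (X4 γ : J0 → J0) = polyField γ 0 0 0 1 0 (2 * γ / (γ - 2)) 0 := by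
  funext p; simp [X4, polyField]

theorem coe_Z (γ : ℝ) :
    (Z γ : J0 → J0) = polyField γ 0 ((γ - 2) / (γ + 2)) 0 0 0 (-(2 * γ / (γ + 2))) 0 := by
  funext p; simp [Z, polyField]

theorem coe_Y (γ : ℝ) :
    (Y γ : J0 → J0) = polyField γ ((γ - 2) / (γ + 2)) 0 0 0 0 0 (-(2 * γ / (γ + 2))) := by
  funext p
  simp only [Y, polyField, Prod.mk.injEq]
  refine ⟨?_, ?_, ?_⟩ <;> ring

theorem commRel (ε : ℝ) :
    CommRel γ ε (X1 γ ε) X2 X3 (X4 γ) (Z γ) (Y γ) := by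
  have e1 := coe_X1 γ ε
  have e2 := coe_X2 γ
  have e3 := coe_X3 γ
  have e4 := coe_X4 γ
  have eZ := coe_Z γ
  have eY := coe_Y γ
  constructor <;> refine Subtype.ext (funext fun p => ?_)
  · rw [lie_polyField e2 e1, Submodule.coe_add, Submodule.coe_smul, e2, eZ]
    simp [polyField]; refine ⟨?_, ?_⟩ <;> ring
  · rw [lie_polyField e2 e4]; simp [polyField]
  · rw [lie_polyField e2 e3]; simp [polyField]
  · rw [lie_polyField e1 e4]; simp [polyField]; ring
  · rw [lie_polyField e1 e3, Submodule.coe_neg, e3]; simp [polyField]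
  · rw [lie_polyField e3 e4, e3]; simp [polyField]
  · rw [lie_polyField e1 eZ, Submodule.coe_smul, eY]
    simp [polyField]; refine ⟨?_, ?_⟩ <;> ring
  · rw [lie_polyField e1 eY, eY]
    simp [polyField]; refine ⟨?_, ?_⟩ <;> ring
  · rw [lie_polyField e2 eY, eZ]; simp [polyField]
  · rw [lie_polyField e2 eZ, Submodule.coe_smul, e2]; simp [polyField]
  · rw [lie_polyField eZ eY, Submodule.coe_smul, eY]
    simp [polyField]; refine ⟨?_, ?_⟩ <;> ring
  · rw [lie_polyField e3 eY]; simp [polyField]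
  · rw [lie_polyField e3 eZ]; simp [polyField]
  · rw [lie_polyField e4 eY]; simp [polyField]; ring
  · rw [lie_polyField e4 eZ]; simp [polyField]; ring

/-! ### Independence, closure and realization -/

theorem polyField_smul_combination (γ : ℝ) (a b c d e : ℝ) (p : J0) :
    (a • X2 + b • X3 + c • X4 γ + d • Z γ + e • Y γ : SmoothVF).1 p =
      polyField γ (e * ((γ - 2) / (γ + 2))) (d * ((γ - 2) / (γ + 2))) a c b
        (c * (2 * γ / (γ - 2)) - d * (2 * γ / (γ + 2))) (-(e * (2 * γ / (γ + 2)))) p := by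
  simp only [Submodule.coe_add, Submodule.coe_smul, coe_X2 γ, coe_X3 γ, coe_X4, coe_Z, coe_Y,
    polyField, Pi.add_apply, Pi.smul_apply, Prod.smul_mk, Prod.mk_add_mk, smul_eq_mul,
    Prod.mk.injEq]
  refine ⟨?_, ?_, ?_⟩ <;> ring

/-- X₁ is left out because it is a combination of X₄, Z and Y. The ∂_t component is quadratic in t,
so t = 0, 1, -1 separate a, d, e; the ∂_x component gives b and c. -/
theorem linearIndependent_operators (h2 : γ ≠ 2) (h2' : γ ≠ -2) {a b c d e : ℝ}
    (h : a • X2 + b • X3 + c • X4 γ + d • Z γ + e • Y γ = 0) :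
    a = 0 ∧ b = 0 ∧ c = 0 ∧ d = 0 ∧ e = 0 := by
  have hκ : (γ - 2) / (γ + 2) ≠ 0 :=
    div_ne_zero (sub_ne_zero.2 h2) fun h => h2' (by linarith)
  have key : ∀ p : J0, _ = (0 : J0) := fun p =>
    (polyField_smul_combination γ a b c d e p).symm.trans (by rw [h]; rfl)
  have k0 := key (0, 0, 0)
  have k1 := key (1, 1, 0)
  have k2 := key (-1, 0, 0)
  simp only [polyField, Prod.mk_eq_zero] at k0 k1 k2
  have ha : a = 0 := by linear_combination k0.1
  have hb : b = 0 := by linear_combination k0.2.1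
  have hc : c = 0 := by linear_combination k1.2.1 - k0.2.1
  have hd : d * ((γ - 2) / (γ + 2)) = 0 := by linear_combination (k1.1 - k2.1) / 2
  have he : e * ((γ - 2) / (γ + 2)) = 0 := by linear_combination k1.1 + k2.1 - 2 * k0.1
  exact ⟨ha, hb, hc, (mul_eq_zero.1 hd).resolve_right hκ, (mul_eq_zero.1 he).resolve_right hκ⟩

theorem spansSl2_operators (h2 : γ ≠ 2) (h2' : γ ≠ -2) : SpansSl2 {X2, Z γ, Y γ} := by
  refine (commRel (γ := γ) 0).spansSl2 h2 h2' fun a b c h => ?_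
  obtain ⟨h1, -, -, h4, h5⟩ := linearIndependent_operators h2 h2'
    (a := a) (b := 0) (c := 0) (d := b) (e := c) (by simpa using h)
  exact ⟨h1, h4, h5⟩

theorem spansSubalgebra_four_iff (h2 : γ ≠ 2) (h2' : γ ≠ -2) (ε : ℝ) :
    SpansSubalgebra {X1 γ ε, X2, X3, X4 γ} ↔ ε = 0 := by
  have hκ : (γ - 2) / (γ + 2) ≠ 0 :=
    div_ne_zero (sub_ne_zero.2 h2) fun h => h2' (by linarith)
  constructor
  · rintro ⟨A, hA⟩
    have hm : ∀ {v}, v ∈ Submodule.span ℝ {X1 γ ε, X2, X3, X4 γ} → v ∈ A := fun h => by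
      rw [← hA] at h; exact h
    have h21 : ⁅X2, X1 γ ε⁆ ∈ Submodule.span ℝ {X1 γ ε, X2, X3, X4 γ} := by
      rw [← hA]
      exact A.lie_mem (hm (Submodule.subset_span (by simp)))
        (hm (Submodule.subset_span (by simp)))
    rw [(commRel ε).x2_x1, Submodule.mem_span_insert] at h21
    obtain ⟨a, w, hw, hs⟩ := h21
    obtain ⟨b, c, d, rfl⟩ := Submodule.mem_span_triple.1 hw
    -- Compare ∂_t components of X₂ + εZ and of the assumed combination on x = u = 0. The t²
    -- coefficient gives aεκ = 0 and the t coefficient gives a = εκ, where κ = (γ-2)/(γ+2) ≠ 0;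
    -- hence ε = 0.
    have key : ∀ t : ℝ, 1 + ε * ((γ - 2) / (γ + 2) * t) =
        a * (ε * ((γ - 2) / (γ + 2)) * (t ^ 2 / 2) + t) + b := fun t => by
      have := congrArg (fun V : SmoothVF => (V.1 (t, 0, 0)).1) hs
      simpa [coe_X1, coe_X2 γ, coe_X3 γ, coe_X4, coe_Z, polyField] using this
    have k0 := key 0
    have k1 := key 1
    have k2 := key (-1)
    have e1 : a * ε * ((γ - 2) / (γ + 2)) = 0 := by linear_combination 2 * k0 - k1 - k2
    have e2 : ε * ((γ - 2) / (γ + 2)) = a := by linear_combination (k1 - k2) / 2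
    rw [← e2] at e1
    simpa [hκ] using e1
  · rintro rfl
    exact (commRel 0).spansSubalgebra_four

/-- The abstract six-dimensional algebra is a central extension of the span of the operators,
realized here in `SmoothVF × SmoothVF`. -/
theorem exists_realization (h2 : γ ≠ 2) (h2' : γ ≠ -2) (ε : ℝ) :
    ∃ (L : Type) (_ : LieRing L) (_ : LieAlgebra ℝ L) (b : Module.Basis (Fin 6) ℝ L)
        (φ : L →ₗ⁅ℝ⁆ SmoothVF),
      CommRel γ ε (b 0) (b 1) (b 2) (b 3) (b 4) (b 5) ∧ SpansSl2 {b 1, b 4, b 5} ∧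
      φ (b 0) = X1 γ ε ∧ φ (b 1) = X2 ∧ φ (b 2) = X3 ∧ φ (b 3) = X4 γ ∧
      φ (b 4) = Z γ ∧ φ (b 5) = Y γ := by
  -- The second component breaks the dependence of X₁ on X₄, Z, Y. Any nonzero field would do: x₁
  -- occurs on no right-hand side of the relations, and all brackets have second component 0.
  let v : Fin 6 → SmoothVF × SmoothVF :=
    ![(X1 γ ε, X2), (X2, 0), (X3, 0), (X4 γ, 0), (Z γ, 0), (Y γ, 0)]
  have h := commRel (γ := γ) ε
  have hv : CommRel γ ε (v 0) (v 1) (v 2) (v 3) (v 4) (v 5) := by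
    constructor <;> refine Prod.ext ?_ (by simp [v])
    exacts [h.x2_x1, h.x2_x4, h.x2_x3, h.x1_x4, h.x1_x3, h.x3_x4, h.x1_z, h.x1_y, h.x2_y,
      h.x2_z, h.z_y, h.x3_y, h.x3_z, h.x4_y, h.x4_z]
  have hli : LinearIndependent ℝ v := by
    rw [Fintype.linearIndependent_iff]
    intro g hg
    rw [Fin.sum_univ_six] at hg
    have h0 : g 0 = 0 := by
      have := congrArg (fun w : SmoothVF × SmoothVF => (w.2.1 0).1) hg
      simpa [v, X2] using this
    have h1 : g 1 • X2 + g 2 • X3 + g 3 • X4 γ + g 4 • Z γ + g 5 • Y γ = 0 := by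
      have := congrArg Prod.fst hg
      simpa [v, h0] using this
    obtain ⟨e1, e2, e3, e4, e5⟩ := linearIndependent_operators h2 h2' h1
    intro i
    fin_cases i
    exacts [h0, e1, e2, e3, e4, e5]
  obtain ⟨A, b, hb, hsl, hbv⟩ := hv.exists_basis h2 h2' hli
  refine ⟨A, inferInstance, inferInstance, b,
    (LieHom.fst ℝ SmoothVF SmoothVF).comp A.incl, hb, hsl, ?_⟩
  have hφ : ∀ i, (LieHom.fst ℝ SmoothVF SmoothVF).comp A.incl (b i) = (v i).1 :=
    fun i => by rw [← hbv i]; rfl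
  exact ⟨hφ 0, hφ 1, hφ 2, hφ 3, hφ 4, hφ 5⟩

theorem CommRel.rotated_triple {L : Type*} [LieRing L] [LieAlgebra ℝ L] {ε : ℝ}
    {x₁ x₂ x₃ x₄ z y : L} (h : CommRel γ ε x₁ x₂ x₃ x₄ z y) (hpos : 0 < (γ + 2) / (γ - 2))
    {T S Z' : L} (hT : T = √(2 * ((γ + 2) / (γ - 2))) • (y + x₂))
    (hS : S = √(2 * ((γ + 2) / (γ - 2))) • (y - x₂))
    (hZ : Z' = (2 * ((γ + 2) / (γ - 2))) • z) :
    ⁅Z', T⁆ = (2 : ℝ) • S ∧ ⁅T, S⁆ = (2 : ℝ) • Z' ∧ ⁅S, Z'⁆ = (-2 : ℝ) • T := by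
  obtain ⟨ρ, hρ⟩ : ∃ ρ, ρ = (γ + 2) / (γ - 2) := ⟨_, rfl⟩
  have hκ : (γ - 2) / (γ + 2) = ρ⁻¹ := by rw [hρ, inv_div]
  rw [← hρ] at hpos hT hS hZ
  -- Positivity of ρ = κ⁻¹ is needed for this square, which enters only in [T, S].
  have hs : √(2 * ρ) * √(2 * ρ) = 2 * ρ := Real.mul_self_sqrt (by positivity)
  generalize √(2 * ρ) = s at *
  have hyx : ⁅y, x₂⁆ = -z := by rw [← lie_skew, h.x2_y]
  have hzx : ⁅z, x₂⁆ = -(ρ⁻¹ • x₂) := by rw [← lie_skew, h.x2_z, hκ]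
  have hyz : ⁅y, z⁆ = -(ρ⁻¹ • y) := by rw [← lie_skew, h.z_y, hκ]
  have hzy := h.z_y
  have hxz := h.x2_z
  rw [hκ] at hzy hxz
  subst hT hS hZ
  refine ⟨?_, ?_, ?_⟩
  · simp only [smul_lie, lie_smul, lie_add, hzy, hzx]
    match_scalars <;> field_simp
  · simp only [smul_lie, lie_smul, lie_sub, add_lie, lie_self, h.x2_y, hyx]
    match_scalars
    linear_combination 2 * hs
  · simp only [smul_lie, lie_smul, sub_lie, hyz, hxz]
    match_scalars <;> field_simp

end

end BinomialWave

end

open BinomialWave in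
theorem mainTheorem5 (γ : ℝ) (h0 : γ ≠ 0) (h1 : γ ≠ 1) (h2 : γ ≠ 2) (h2' : γ ≠ -2) :
    -- symmetries, over any connected open region of points `(t, x, u)` with `1 + u/γ > 0`
    (∀ D : Set J0, IsOpen D → IsPreconnected D → D ⊆ posRegion γ →
      -- all approximate generators
      (∀ c k : Fin 4 → ℝ, IsApproxSymmetry γ D (generalX γ c k)) ∧
      (γ ≠ 2 / 3 → ∀ V₀ V₁ : J0 → J0, ContDiffOn ℝ ∞ V₀ D → ContDiffOn ℝ ∞ V₁ D →
        (IsApproxSymmetry γ D (fun ε p => V₀ p + ε • V₁ p) ↔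
          ∃ c k : Fin 4 → ℝ, ∀ ε : ℝ, ∀ p ∈ D, V₀ p + ε • V₁ p = generalX γ c k ε p)) ∧
      IsApproxSymmetry γ D (fun ε => X1 γ ε) ∧ IsApproxSymmetry γ D (fun _ => X2) ∧
      IsApproxSymmetry γ D (fun _ => X3) ∧ IsApproxSymmetry γ D (fun _ => X4 γ) ∧
      -- exact generators for `ε = 0`
      IsSymmetry γ 0 D X10 ∧ IsSymmetry γ 0 D X2 ∧
      IsSymmetry γ 0 D X3 ∧ IsSymmetry γ 0 D (X4 γ) ∧
      (γ ≠ 2 / 3 → ∀ V : J0 → J0, ContDiffOn ℝ ∞ V D →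
        (IsSymmetry γ 0 D V ↔ ∃ c : Fin 4 → ℝ, ∀ p ∈ D, V p =
          (c 0 • X10 + c 1 • X2 + c 2 • X3 + c 3 • X4 γ : SmoothVF).1 p))) ∧
    -- the general generator in terms of the basic operators
    (∀ (c k : Fin 4 → ℝ) (ε : ℝ), generalX γ c k ε =
      (c 0 • X1 γ ε + c 1 • X2 + c 3 • X3 + c 2 • X4 γ
        + ε • (k 0 • X10 + k 1 • X2 + k 3 • X3 + k 2 • X4 γ) : SmoothVF).1) ∧
    -- commutation relations, for every real value of `ε`
    (∀ ε : ℝ,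
      CommRel γ ε (X1 γ ε) X2 X3 (X4 γ) (Z γ) (Y γ) ∧
      (SpansSubalgebra {X1 γ ε, X2, X3, X4 γ} ↔ ε = 0) ∧
      SpansSubalgebra {X1 γ ε, X2, X3, X4 γ, Z γ, Y γ} ∧
      -- the abstract six-dimensional Lie algebra, of which these operators are a realization
      (∃ (L : Type) (_ : LieRing L) (_ : LieAlgebra ℝ L) (b : Module.Basis (Fin 6) ℝ L)
          (φ : L →ₗ⁅ℝ⁆ SmoothVF),
        CommRel γ ε (b 0) (b 1) (b 2) (b 3) (b 4) (b 5) ∧ SpansSl2 {b 1, b 4, b 5} ∧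
        φ (b 0) = X1 γ ε ∧ φ (b 1) = X2 ∧ φ (b 2) = X3 ∧ φ (b 3) = X4 γ ∧
        φ (b 4) = Z γ ∧ φ (b 5) = Y γ)) ∧
    -- the `sl(2, ℝ)` subalgebra
    SpansSl2 {X2, Z γ, Y γ} ∧
    (0 < (γ + 2) / (γ - 2) → ∀ T S Z' : SmoothVF,
      T = √(2 * ((γ + 2) / (γ - 2))) • (Y γ + X2) →
      S = √(2 * ((γ + 2) / (γ - 2))) • (Y γ - X2) →
      Z' = (2 * ((γ + 2) / (γ - 2))) • Z γ →
      ⁅Z', T⁆ = (2 : ℝ) • S ∧ ⁅T, S⁆ = (2 : ℝ) • Z' ∧ ⁅S, Z'⁆ = (-2 : ℝ) • T) := by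
  refine ⟨fun D hDo hDc hD => ?_, generalX_eq h2, fun ε => ?_, spansSl2_operators h2 h2',
    fun hpos T S Z' hT hS hZ => (commRel 0).rotated_triple hpos hT hS hZ⟩
  · have happ := isApproxSymmetry_generalX h0 h2 h2' hDo hD
    have hex := isSymmetry_exactX h0 h2 hD
    refine ⟨happ, fun h3 V₀ V₁ hV₀ hV₁ =>
        isApproxSymmetry_iff h0 h1 h2 h2' h3 hDo hDc hD hV₀ hV₁,
      ?_, ?_, ?_, ?_, ?_, ?_, ?_, ?_,
      fun h3 V hV => isSymmetry_iff h0 h1 h2 h2' h3 hDo hDc hD hV⟩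
    · exact (happ ![1, 0, 0, 0] 0).congr hDo fun ε p _ => by rw [generalX_eq h2]; simp
    · exact (happ ![0, 1, 0, 0] 0).congr hDo fun ε p _ => by rw [generalX_eq h2]; simp
    · exact (happ ![0, 0, 0, 1] 0).congr hDo fun ε p _ => by rw [generalX_eq h2]; simp
    · exact (happ ![0, 0, 1, 0] 0).congr hDo fun ε p _ => by rw [generalX_eq h2]; simp
    · simpa using hex ![1, 0, 0, 0]
    · simpa using hex ![0, 1, 0, 0]
    · simpa using hex ![0, 0, 1, 0]
    · simpa using hex ![0, 0, 0, 1]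
  · exact ⟨commRel ε, spansSubalgebra_four_iff h2 h2' ε, (commRel ε).spansSubalgebra,
      exists_realization h2 h2' ε⟩
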